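/- Let $n\ge 1$, let $q\in\mathbb C^\times$ not be a root of unity, fix $\hbar\in\mathbb C$ with $e^{\hbar}=q$, and put $q^z=e^{\hbar z}$ for $z\in\mathbb C$, $\theta=q^{1/2}-q^{-1/2}$, $[z]_q=\frac{q^z-q^{-z}}{q-q^{-1}}$, $[m]_q!=\prod_{j=1}^m[j]_q$ and $[x,y]_a=xy-a\,yx$. Let $\varepsilon_1,\dots,\varepsilon_n$ be an orthonormal basis of $\mathfrak h^*$ for the complex bilinear form $(\cdot,\cdot)$, and let $\alpha_1=\varepsilon_1$, $\alpha_i=\varepsilon_i-\varepsilon_{i-1}$ $(2\le i\le n)$ be the simple roots of $\mathfrak g=\mathfrak{so}(2n+1)$. Let $U_q(\mathfrak g)$ be the unital associative $\mathbb C$-algebra generated by $q^{\pm h_{\alpha}}$, $e_{\alpha}$, $f_{\alpha}$ ($\alpha$ a simple root), where $q^{h_\alpha}$ and $q^{-h_\alpha}$ are mutually inverse and the $q^{h_\alpha}$ commute with each other, with the relations $$q^{h_\alpha}e_{\beta}q^{-h_\alpha}=q^{(\alpha,\beta)}e_\beta,\qquad q^{h_\alpha}f_{\beta}q^{-h_\alpha}=q^{-(\alpha,\beta)}f_\beta,\qquad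 [e_\alpha,f_\beta]=\delta_{\alpha,\beta}\frac{q^{h_\alpha}-q^{-h_\alpha}}{q-q^{-1}},$$ and, both for $x=e$ and for $x=f$: $[x_\alpha,[x_\alpha,x_\beta]_q]_{q^{-1}}=0$ if $2(\alpha,\beta)/(\alpha,\alpha)=-1$; $[x_\alpha,x_\beta]=0$ if $(\alpha,\beta)=0$; and, if $n\ge2$, $[x_{\alpha_1},[x_{\alpha_1},[x_{\alpha_1},x_{\alpha_2}]_q]_{q^{-1}}]=0$. Set $$f_{\varepsilon_i}=[\dots[f_{\alpha_1},f_{\alpha_2}]_{q^{-1}},\dots f_{\alpha_i}]_{q^{-1}},\qquad e_{\varepsilon_i}=[\dots[e_{\alpha_i},e_{\alpha_{i-1}}]_q,\dots e_{\alpha_1}]_q .$$ Let $U_q(\mathfrak h)$ be the subalgebra generated by the $q^{\pm h_\alpha}$. Then, as vector spaces, $$U_q(\mathfrak g)=U_q(\mathfrak h)\oplus\Big(\sum_\alpha f_\alpha U_q(\mathfrak g)+\sum_\alpha U_q(\mathfrak g)e_\alpha\Big).$$ Let $\lambda\in\mathfrak h^*$ satisfy $q^{2(\lambda,\varepsilon_i)}=-q^{-1}$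 for all $i$ and $(\lambda,\alpha_i)=0$ for $i>1$. Then there is a unique algebra homomorphism $U_q(\mathfrak h)\to\mathbb C$ with $q^{h_\alpha}\mapsto q^{(\lambda,\alpha)}$ for all simple roots $\alpha$ (evaluation at $\lambda$). Denote by $\langle x\rangle$ the value at $\lambda$ of the projection of $x\in U_q(\mathfrak g)$ onto $U_q(\mathfrak h)$ along the second summand above. **Lemma.** For all non-negative integers $k_1,\dots,k_n,m_1,\dots,m_n$, $$\big\langle e_{\varepsilon_n}^{k_n}\cdots e_{\varepsilon_1}^{k_1}\, f_{\varepsilon_1}^{m_1}\cdots f_{\varepsilon_n}^{m_n}\big\rangle=\prod_{i=1}^n\delta_{k_i,m_i}\,[m_i]_q!\;\theta^{-m_i}\,q^{-m_i(\lambda,\varepsilon_i)-\frac{m_i}{2}}\,(-1)^{m_i}.$$ The direct sum decomposition and the existence and uniqueness of the evaluation are part of the claim. -/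

import Mathlib

noncomputable section

namespace QSO

/-- The simple roots of `so(2n+1)` in the orthonormal basis `ε₀, …, ε_{n-1}` of the short positive
roots: `α₀ = ε₀` and `αᵢ = εᵢ - εᵢ₋₁` for `i > 0`. (Indices start at `0` instead of `1`.) -/
def simpleRoot {n : ℕ} (i : Fin n) : Fin n → ℤ := fun j =>
  if j = i then 1 else if (j : ℕ) + 1 = (i : ℕ) then -1 else 0

/-- The inner product `(αᵢ, αⱼ)` of simple roots; short roots have length `1`. -/
def rootForm {n : ℕ} (i j : Fin n) : ℤ := ∑ l, simpleRoot i l * simpleRoot j l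

/-- The pairing `(lam, αᵢ)` of a weight with a simple root. A weight is given by its
coordinates `lam l = (lam, ε_l)`. -/
def weightForm {n : ℕ} (lam : Fin n → ℂ) (i : Fin n) : ℂ := ∑ l, lam l * (simpleRoot i l : ℂ)

/-- The `a`-commutator `[x, y]_a = x y - a y x`. -/
def qcomm {A : Type*} [Ring A] [Algebra ℂ A] (a : ℂ) (x y : A) : A := x * y - a • (y * x)

/-- The generators `q^{h_α}`, `q^{-h_α}`, `e_α`, `f_α = e_{-α}`, for `α = αᵢ` simple. -/
inductive Gen (n : ℕ) : Type
  | K (i : Fin n) : Gen n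
  | Kinv (i : Fin n) : Gen n
  | e (i : Fin n) : Gen n
  | f (i : Fin n) : Gen n

section Relations

open FreeAlgebra

/-- The defining relations of `U_q(so(2n+1))`. -/
inductive Rel (n : ℕ) (q : ℂ) : FreeAlgebra ℂ (Gen n) → FreeAlgebra ℂ (Gen n) → Prop
  | K_mul_Kinv (i : Fin n) : Rel n q (ι ℂ (Gen.K i) * ι ℂ (Gen.Kinv i)) 1
  | Kinv_mul_K (i : Fin n) : Rel n q (ι ℂ (Gen.Kinv i) * ι ℂ (Gen.K i)) 1
  | K_comm (i j : Fin n) :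
      Rel n q (ι ℂ (Gen.K i) * ι ℂ (Gen.K j)) (ι ℂ (Gen.K j) * ι ℂ (Gen.K i))
  | K_e (i j : Fin n) :
      Rel n q (ι ℂ (Gen.K i) * ι ℂ (Gen.e j) * ι ℂ (Gen.Kinv i))
        (q ^ rootForm i j • ι ℂ (Gen.e j))
  | K_f (i j : Fin n) :
      Rel n q (ι ℂ (Gen.K i) * ι ℂ (Gen.f j) * ι ℂ (Gen.Kinv i))
        (q ^ (-rootForm i j) • ι ℂ (Gen.f j))
  | e_f (i j : Fin n) :
      Rel n q (qcomm 1 (ι ℂ (Gen.e i)) (ι ℂ (Gen.f j)))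
        (if i = j then (q - q⁻¹)⁻¹ • (ι ℂ (Gen.K i) - ι ℂ (Gen.Kinv i)) else 0)
  | serre_e (i j : Fin n) (h : 2 * rootForm i j = -rootForm i i) :
      Rel n q (qcomm q⁻¹ (ι ℂ (Gen.e i)) (qcomm q (ι ℂ (Gen.e i)) (ι ℂ (Gen.e j)))) 0
  | serre_f (i j : Fin n) (h : 2 * rootForm i j = -rootForm i i) :
      Rel n q (qcomm q⁻¹ (ι ℂ (Gen.f i)) (qcomm q (ι ℂ (Gen.f i)) (ι ℂ (Gen.f j)))) 0
  | serre_short_e (i j : Fin n) (hi : (i : ℕ) = 0) (hj : (j : ℕ) = 1) :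
      Rel n q (qcomm 1 (ι ℂ (Gen.e i)) (qcomm q⁻¹ (ι ℂ (Gen.e i))
        (qcomm q (ι ℂ (Gen.e i)) (ι ℂ (Gen.e j))))) 0
  | serre_short_f (i j : Fin n) (hi : (i : ℕ) = 0) (hj : (j : ℕ) = 1) :
      Rel n q (qcomm 1 (ι ℂ (Gen.f i)) (qcomm q⁻¹ (ι ℂ (Gen.f i))
        (qcomm q (ι ℂ (Gen.f i)) (ι ℂ (Gen.f j))))) 0
  | e_comm (i j : Fin n) (h : rootForm i j = 0) :
      Rel n q (qcomm 1 (ι ℂ (Gen.e i)) (ι ℂ (Gen.e j))) 0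
  | f_comm (i j : Fin n) (h : rootForm i j = 0) :
      Rel n q (qcomm 1 (ι ℂ (Gen.f i)) (ι ℂ (Gen.f j))) 0

end Relations

/-- The quantum group `U_q(so(2n+1))`, as a `ℂ`-algebra. -/
abbrev Uq (n : ℕ) (q : ℂ) : Type := RingQuot (Rel n q)

/-- The image of a generator in `U_q(so(2n+1))`. -/
def gen {n : ℕ} (q : ℂ) (x : Gen n) : Uq n q :=
  RingQuot.mkAlgHom ℂ (Rel n q) (FreeAlgebra.ι ℂ x)

/-- `f_{ε₀} = f_{α₀}` and `f_{ε_{i+1}} = [f_{ε_i}, f_{α_{i+1}}]_{q⁻¹}`, that is,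
`f_{ε_i} = [… [f_{α₀}, f_{α₁}]_{q⁻¹}, … f_{α_i}]_{q⁻¹}`. -/
def fEps {n : ℕ} (q : ℂ) : (i : ℕ) → i < n → Uq n q
  | 0, h => gen q (Gen.f ⟨0, h⟩)
  | i + 1, h => qcomm q⁻¹ (fEps q i (Nat.lt_of_succ_lt h)) (gen q (Gen.f ⟨i + 1, h⟩))

/-- The nested commutator `[… [[x, e_{α_{j-1}}]_q, e_{α_{j-2}}]_q, … e_{α₀}]_q`. -/
def eNest {n : ℕ} (q : ℂ) (x : Uq n q) : (j : ℕ) → j ≤ n → Uq n q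
  | 0, _ => x
  | j + 1, h => eNest q (qcomm q x (gen q (Gen.e ⟨j, h⟩))) j (Nat.le_of_succ_le h)

/-- `e_{ε_i} = [… [e_{α_i}, e_{α_{i-1}}]_q, … e_{α₀}]_q`. -/
def eEps {n : ℕ} (q : ℂ) (i : Fin n) : Uq n q :=
  eNest q (gen q (Gen.e i)) i i.isLt.le

/-- `f_{ε₀}^{m₀} f_{ε₁}^{m₁} ⋯ f_{ε_{n-1}}^{m_{n-1}}`. -/
def fMonomial {n : ℕ} (q : ℂ) (m : Fin n → ℕ) : Uq n q :=
  (List.ofFn fun i : Fin n => fEps q i i.isLt ^ m i).prod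

/-- `e_{ε_{n-1}}^{k_{n-1}} ⋯ e_{ε₁}^{k₁} e_{ε₀}^{k₀}`. -/
def eMonomial {n : ℕ} (q : ℂ) (k : Fin n → ℕ) : Uq n q :=
  (List.ofFn fun i : Fin n => eEps q i ^ k i).reverse.prod

/-- The Cartan subalgebra `U_q(h)`, generated by the `q^{± h_α}`. -/
def cartan (n : ℕ) (q : ℂ) : Subalgebra ℂ (Uq n q) :=
  Algebra.adjoin ℂ
    (Set.range (fun i : Fin n => gen q (Gen.K i)) ∪ Set.range (fun i => gen q (Gen.Kinv i)))

/-- The subspace `g₋ U_q(g) + U_q(g) g₊`. -/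
def offCartan (n : ℕ) (q : ℂ) : Submodule ℂ (Uq n q) :=
  Submodule.span ℂ {y | ∃ (i : Fin n) (x : Uq n q), y = gen q (Gen.f i) * x} ⊔
    Submodule.span ℂ {y | ∃ (i : Fin n) (x : Uq n q), y = x * gen q (Gen.e i)}

/-- The direct sum decomposition `U_q(g) = U_q(h) ⊕ (g₋ U_q(g) + U_q(g) g₊)`. -/
def CartanSplits (n : ℕ) (q : ℂ) : Prop :=
  IsCompl (Subalgebra.toSubmodule (cartan n q)) (offCartan n q)

/-- The Harish-Chandra projection of `U_q(g)` onto `U_q(h)` along `g₋ U_q(g) + U_q(g) g₊`. -/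
def harishChandra {n : ℕ} {q : ℂ} (h : CartanSplits n q) : Uq n q →ₗ[ℂ] cartan n q :=
  Submodule.projectionOnto (Subalgebra.toSubmodule (cartan n q)) (offCartan n q) h

/-- The element `q^{h_α}`, `α = αᵢ`, of the Cartan subalgebra. -/
def cartanK {n : ℕ} (q : ℂ) (i : Fin n) : cartan n q :=
  ⟨gen q (Gen.K i), Algebra.subset_adjoin (Or.inl ⟨i, rfl⟩)⟩

/-- `ev` is the evaluation of `U_q(h)` at the weight `lam`, i.e. `q^{h_α} ↦ q^{(lam, α)}` for
simple `α`. Powers of `q = exp hbar` are `q^z = exp (hbar z)`. -/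
def IsEvalAt {n : ℕ} {q : ℂ} (hbar : ℂ) (lam : Fin n → ℂ) (ev : cartan n q →ₐ[ℂ] ℂ) : Prop :=
  ∀ i : Fin n, ev (cartanK q i) = Complex.exp (hbar * weightForm lam i)

/-- `[m]_q = (q^m - q^{-m}) / (q - q⁻¹)`. -/
def qNum (q : ℂ) (m : ℕ) : ℂ := (q ^ m - (q ^ m)⁻¹) / (q - q⁻¹)

/-- `[m]_q! = [1]_q [2]_q ⋯ [m]_q`. -/
def qFactorial (q : ℂ) (m : ℕ) : ℂ := ∏ j ∈ Finset.range m, qNum q (j + 1)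

end QSO

end

/-! The proof rests on linear functionals `Φ` on the algebra that kill every `f_α U` and `U e_α`,
send `1` to `1`, and turn left multiplication by `q^{± h_α}` into a scalar weight
(`IsHighestWeightFunctional`). Such a `Φ` vanishes on the second summand and is multiplicative on
the Cartan subalgebra, so it is a character composed with the projection (`eval_harishChandra`).

Decomposition: the two summands span by commuting generators past each other. They meet trivially
because there is a `Φ` with values in the Cartan subalgebra that restricts to the identity there. It
is a vacuum matrix coefficient on the free module on words in the `f_α`, a Verma module before the
Serre relations are imposed. The `f`-Serre elements need not act by zero on it. However, Serre
elements commute with the opposite Chevalley generators, so the `e`-Serre elements act by zero since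
they kill the vacuum, and the `f`-Serre elements are invisible to vacuum coefficients. Hence the
functional descends to the quotient algebra even though the module need not
(`exists_isHighestWeightFunctional`). With complex coefficients the same construction gives the
evaluation at `λ`.

Formula: for the given `λ` there is an explicit representation by weighted shifts
(`exists_oscillator`), in which `f_{ε_i}` raises and `e_{ε_i}` lowers the `i`th occupation number.
Put `κ = q^{(λ,ε_i)}`; the condition `κ² = -q⁻¹` is what makes the short-root relation `[e, f]`
hold, with the constant `C = -(κ(q-1))⁻¹`. The vacuum coefficient of this representation is a
highest weight functional of weight `λ`, so it computes the bracket. An `f`-monomial sends the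
vacuum to a multiple of a basis vector that determines the exponents; the powers of `-q` and `-q⁻¹`
cancel, and `∏ C^{m_i} [m_i]_q!` remains. Finally `θ q^{1/2} = q - 1` gives the stated form. -/

noncomputable section

namespace QSO

/-! ### Inner products of simple roots. -/

section RootForm

variable {n : ℕ}

theorem simpleRoot_of_val_eq_zero {i : Fin n} (hi : (i : ℕ) = 0) :
    (simpleRoot i : Fin n → ℤ) = Pi.single i 1 := by
  funext j
  simp [simpleRoot, Pi.single_apply, hi]

theorem simpleRoot_of_val_eq_succ {i k : Fin n} (hi : (i : ℕ) = k + 1) :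
    (simpleRoot i : Fin n → ℤ) = Pi.single i 1 - Pi.single k 1 := by
  funext j
  simp only [simpleRoot, Pi.sub_apply, Pi.single_apply, Fin.ext_iff, hi]
  split_ifs <;> omega

theorem rootForm_comm (i j : Fin n) : rootForm i j = rootForm j i := by
  simp [rootForm, mul_comm]

theorem rootForm_eq (i j : Fin n) : rootForm i j =
    if i = j then (if (i : ℕ) = 0 then 1 else 2)
    else if (i : ℕ) + 1 = j ∨ (j : ℕ) + 1 = i then -1 else 0 := by
  rcases Nat.eq_zero_or_pos (i : ℕ) with hi | hi
  · have h : rootForm i j = simpleRoot j i := by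
      simp [rootForm, simpleRoot_of_val_eq_zero hi, Pi.single_apply]
    rw [h]
    simp only [simpleRoot, Fin.ext_iff, hi]
    split_ifs <;> simp_all
  · obtain ⟨k, hk⟩ : ∃ k : Fin n, (i : ℕ) = k + 1 := ⟨⟨i - 1, by omega⟩, by simp; omega⟩
    have h : rootForm i j = simpleRoot j i - simpleRoot j k := by
      rw [rootForm, simpleRoot_of_val_eq_succ hk]
      simp [Pi.single_apply, sub_mul]
    rw [h]
    simp only [simpleRoot, Fin.ext_iff, hk]
    split_ifs <;> first | omega | simp_all

theorem rootForm_of_serre {i j : Fin n} (h : 2 * rootForm i j = -rootForm i i) :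
    i ≠ j ∧ rootForm i i = 2 ∧ rootForm i j = -1 := by
  rw [rootForm_eq i j, rootForm_eq i i] at *
  simp only [if_true] at *
  split_ifs at * <;> simp_all

theorem rootForm_of_short {i j : Fin n} (hi : (i : ℕ) = 0) (hj : (j : ℕ) = 1) :
    i ≠ j ∧ rootForm i i = 1 ∧ rootForm i j = -1 := by
  rw [rootForm_eq i j, rootForm_eq i i]
  simp [Fin.ext_iff, hi, hj]

theorem ne_of_rootForm_eq_zero {i j : Fin n} (h : rootForm i j = 0) : i ≠ j := by
  rintro rfl
  rw [rootForm_eq] at h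
  split_ifs at h <;> simp_all

end RootForm

/-! ### Serre elements commute with the opposite Chevalley generators. -/

section SerreCommute

variable {A : Type*} [Ring A] [Algebra ℂ A] {q t : ℂ} {x y f K K' : A}

theorem commute_qcomm_one (hx : x * f = f * x + t • (K - K')) (hy : y * f = f * y)
    (hKy : K * y = y * K) (hKy' : K' * y = y * K') : Commute f (qcomm 1 x y) := by
  have hx' (z) : x * (f * z) = f * (x * z) + t • (K * z - K' * z) := by
    rw [← mul_assoc, hx]; simp only [add_mul, smul_mul_assoc, sub_mul, mul_assoc]
  have hy' (z) : y * (f * z) = f * (y * z) := by rw [← mul_assoc, hy, mul_assoc]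
  simp only [Commute, SemiconjBy, qcomm, mul_sub, sub_mul, mul_assoc, mul_smul_comm,
    smul_mul_assoc, hx, hx', hy, hy', hKy, hKy', mul_add, smul_sub, smul_add]
  module

theorem commute_qcomm_one' (hx : x * f = f * x) (hy : y * f = f * y + t • (K - K'))
    (hKx : K * x = x * K) (hKx' : K' * x = x * K') : Commute f (qcomm 1 x y) := by
  have h := (commute_qcomm_one hy hx hKx hKx').neg_right
  convert h using 1
  simp [qcomm]

/-- The case where `f` is opposite to the repeated generator. After `f` is moved to the left and
`K`, `K'` to the right, the leftover terms cancel monomial by monomial, so the scalar `t` can stay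
arbitrary. -/
theorem commute_serre_left (hq : q ≠ 0) (hx : x * f = f * x + t • (K - K')) (hy : y * f = f * y)
    (hKx : K * x = q ^ 2 • (x * K)) (hKy : K * y = q⁻¹ • (y * K))
    (hKx' : K' * x = (q ^ 2)⁻¹ • (x * K')) (hKy' : K' * y = q • (y * K')) :
    Commute f (qcomm q⁻¹ x (qcomm q x y)) := by
  have hx2 (z) : x * (f * z) = f * (x * z) + t • (K * z - K' * z) := by
    rw [← mul_assoc, hx]; simp only [add_mul, smul_mul_assoc, sub_mul, mul_assoc]
  have hy2 (z) : y * (f * z) = f * (y * z) := by rw [← mul_assoc, hy, mul_assoc]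
  have hKx2 (z) : K * (x * z) = q ^ 2 • (x * (K * z)) := by
    rw [← mul_assoc, hKx, smul_mul_assoc, mul_assoc]
  have hKy2 (z) : K * (y * z) = q⁻¹ • (y * (K * z)) := by
    rw [← mul_assoc, hKy, smul_mul_assoc, mul_assoc]
  have hKx2' (z) : K' * (x * z) = (q ^ 2)⁻¹ • (x * (K' * z)) := by
    rw [← mul_assoc, hKx', smul_mul_assoc, mul_assoc]
  have hKy2' (z) : K' * (y * z) = q • (y * (K' * z)) := by
    rw [← mul_assoc, hKy', smul_mul_assoc, mul_assoc]
  simp only [Commute, SemiconjBy, qcomm, mul_sub, sub_mul, mul_assoc, mul_smul_comm,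
    smul_mul_assoc, hx, hx2, hy, hy2, hKx, hKy, hKx', hKy', hKx2, hKy2, hKx2', hKy2', mul_add,
    smul_sub, smul_add]
  match_scalars <;> field_simp <;> ring

theorem commute_serre_right (hq : q ≠ 0) (hx : x * f = f * x) (hy : y * f = f * y + t • (K - K'))
    (hKx : K * x = q⁻¹ • (x * K)) (hKx' : K' * x = q • (x * K')) :
    Commute f (qcomm q⁻¹ x (qcomm q x y)) := by
  have hy2 (z) : y * (f * z) = f * (y * z) + t • (K * z - K' * z) := by
    rw [← mul_assoc, hy]; simp only [add_mul, smul_mul_assoc, sub_mul, mul_assoc]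
  have hx2 (z) : x * (f * z) = f * (x * z) := by rw [← mul_assoc, hx, mul_assoc]
  have hKx2 (z) : K * (x * z) = q⁻¹ • (x * (K * z)) := by
    rw [← mul_assoc, hKx, smul_mul_assoc, mul_assoc]
  have hKx2' (z) : K' * (x * z) = q • (x * (K' * z)) := by
    rw [← mul_assoc, hKx', smul_mul_assoc, mul_assoc]
  simp only [Commute, SemiconjBy, qcomm, mul_sub, sub_mul, mul_assoc, mul_smul_comm,
    smul_mul_assoc, hx, hx2, hy, hy2, hKx, hKx', hKx2, hKx2', mul_add,
    smul_sub, smul_add]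
  match_scalars <;> field_simp <;> ring

theorem commute_serre_short_left (hq : q ≠ 0) (hx : x * f = f * x + t • (K - K'))
    (hy : y * f = f * y)
    (hKx : K * x = q • (x * K)) (hKy : K * y = q⁻¹ • (y * K))
    (hKx' : K' * x = q⁻¹ • (x * K')) (hKy' : K' * y = q • (y * K')) :
    Commute f (qcomm 1 x (qcomm q⁻¹ x (qcomm q x y))) := by
  have hx2 (z) : x * (f * z) = f * (x * z) + t • (K * z - K' * z) := by
    rw [← mul_assoc, hx]; simp only [add_mul, smul_mul_assoc, sub_mul, mul_assoc]
  have hy2 (z) : y * (f * z) = f * (y * z) := by rw [← mul_assoc, hy, mul_assoc]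
  have hKx2 (z) : K * (x * z) = q • (x * (K * z)) := by
    rw [← mul_assoc, hKx, smul_mul_assoc, mul_assoc]
  have hKy2 (z) : K * (y * z) = q⁻¹ • (y * (K * z)) := by
    rw [← mul_assoc, hKy, smul_mul_assoc, mul_assoc]
  have hKx2' (z) : K' * (x * z) = q⁻¹ • (x * (K' * z)) := by
    rw [← mul_assoc, hKx', smul_mul_assoc, mul_assoc]
  have hKy2' (z) : K' * (y * z) = q • (y * (K' * z)) := by
    rw [← mul_assoc, hKy', smul_mul_assoc, mul_assoc]
  simp only [Commute, SemiconjBy, qcomm, mul_sub, sub_mul, mul_assoc, mul_smul_comm,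
    smul_mul_assoc, hx, hx2, hy, hy2, hKx, hKy, hKx', hKy', hKx2, hKy2, hKx2', hKy2', mul_add,
    smul_sub, smul_add]
  match_scalars <;> field_simp <;> ring

/-- The inner element commutes with `f` by `commute_serre_right`, whose hypotheses do not see the
length of the root of `x`. -/
theorem commute_serre_short_right (hq : q ≠ 0) (hx : x * f = f * x)
    (hy : y * f = f * y + t • (K - K'))
    (hKx : K * x = q⁻¹ • (x * K)) (hKx' : K' * x = q • (x * K')) :
    Commute f (qcomm 1 x (qcomm q⁻¹ x (qcomm q x y))) := by
  have h := commute_serre_right hq hx hy hKx hKx'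
  have hx' : Commute f x := hx.symm
  unfold qcomm at *
  exact (hx'.mul_right h).sub_right (((h.mul_right hx')).smul_right _)

end SerreCommute

/-- Elements of an algebra that satisfy the relations of `U_q(so(2n+1))` other than those between
the `e`s alone and between the `f`s alone. -/
structure ChevalleyFamily {n : ℕ} (q : ℂ) {A : Type*} [Ring A] [Algebra ℂ A]
    (e f K K' : Fin n → A) : Prop where
  K_mul (i) : K i * K' i = 1
  mul_K (i) : K' i * K i = 1
  K_comm (i j) : K i * K j = K j * K i
  K_e (i j) : K i * e j = q ^ rootForm i j • (e j * K i)
  K_f (i j) : K i * f j = q ^ (-rootForm i j) • (f j * K i)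
  e_f (i j) : e i * f j = f j * e i + if i = j then (q - q⁻¹)⁻¹ • (K i - K' i) else 0

namespace ChevalleyFamily

variable {n : ℕ} {q : ℂ} {A : Type*} [Ring A] [Algebra ℂ A] {e f K K' : Fin n → A}

theorem inv_comm {c : ℂ} (hc : c ≠ 0) {k k' x : A} (h : k * k' = 1) (h' : k' * k = 1)
    (hx : k * x = c • (x * k)) : k' * x = c⁻¹ • (x * k') := by
  have : c • (k' * x) = x * k' := by
    calc c • (k' * x) = k' * (c • (x * k)) * k' := by
          simp only [mul_smul_comm, smul_mul_assoc, mul_assoc, h, mul_one]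
      _ = x * k' := by rw [← hx, ← mul_assoc, h', one_mul]
  rw [← this, smul_smul, inv_mul_cancel₀ hc, one_smul]

theorem K'_e (hf : ChevalleyFamily q e f K K') (hq : q ≠ 0) (i j : Fin n) :
    K' i * e j = q ^ (-rootForm i j) • (e j * K' i) := by
  rw [zpow_neg]
  exact inv_comm (zpow_ne_zero _ hq) (hf.K_mul i) (hf.mul_K i) (hf.K_e i j)

theorem K'_f (hf : ChevalleyFamily q e f K K') (hq : q ≠ 0) (i j : Fin n) :
    K' i * f j = q ^ rootForm i j • (f j * K' i) := by
  rw [← inv_inv (q ^ rootForm i j), ← zpow_neg]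
  exact inv_comm (zpow_ne_zero _ hq) (hf.K_mul i) (hf.mul_K i) (hf.K_f i j)

theorem K'_comm (hf : ChevalleyFamily q e f K K') (i j : Fin n) :
    K' i * K' j = K' j * K' i := by
  have h1 (j : Fin n) : K' i * K j = K j * K' i := by
    simpa using inv_comm one_ne_zero (hf.K_mul i) (hf.mul_K i) (x := K j)
      (by simpa using hf.K_comm i j)
  simpa using inv_comm one_ne_zero (hf.K_mul j) (hf.mul_K j) (x := K' i)
      (by simpa using (h1 j).symm) |>.symm

/-- Exchanging `e` with `f` and `K` with `K'` preserves these relations, so facts on `e`-Serre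
elements transfer to `f`-Serre elements. -/
theorem symm (hf : ChevalleyFamily q e f K K') (hq : q ≠ 0) : ChevalleyFamily q f e K' K where
  K_mul := hf.mul_K
  mul_K := hf.K_mul
  K_comm := hf.K'_comm
  K_e := hf.K'_f hq
  K_f := hf.K'_e hq
  e_f i j := by
    rw [hf.e_f j i, add_assoc]
    rcases eq_or_ne i j with rfl | h
    · simp only [if_true]; module
    · simp [h, h.symm]

theorem qcomm_e_f (hf : ChevalleyFamily q e f K K') (i j : Fin n) :
    qcomm 1 (e i) (f j) = if i = j then (q - q⁻¹)⁻¹ • (K i - K' i) else 0 := by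
  rw [qcomm, one_smul, hf.e_f, add_sub_cancel_left]

/-- Since `i ≠ j`, the generator `f k` fails to commute with at most one of `e i` and `e j`; each of
the three cases is a direct computation. -/
theorem commute_serre (hf : ChevalleyFamily q e f K K') (hq : q ≠ 0) {i j : Fin n}
    (h : 2 * rootForm i j = -rootForm i i) (k : Fin n) :
    Commute (f k) (qcomm q⁻¹ (e i) (qcomm q (e i) (e j))) := by
  obtain ⟨hij, hii, hr⟩ := rootForm_of_serre h
  have hr' : rootForm j i = -1 := by rw [rootForm_comm, hr]
  have hi := hf.e_f i k
  have hj := hf.e_f j k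
  rcases eq_or_ne i k with rfl | hik
  · simp only [if_true, hij.symm, if_false, add_zero] at hi hj
    refine commute_serre_left hq hi hj ?_ ?_ ?_ ?_
    · simpa [hii] using hf.K_e i i
    · simpa [hr] using hf.K_e i j
    · simpa [hii] using hf.K'_e hq i i
    · simpa [hr] using hf.K'_e hq i j
  rcases eq_or_ne j k with rfl | hjk
  · simp only [if_true, hij, if_false, add_zero] at hi hj
    refine commute_serre_right hq hi hj ?_ ?_
    · simpa [hr'] using hf.K_e j i
    · simpa [hr'] using hf.K'_e hq j i
  simp only [hik, hjk, if_false, add_zero] at hi hj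
  replace hi : Commute (f k) (e i) := hi.symm
  replace hj : Commute (f k) (e j) := hj.symm
  have h1 : Commute (f k) (qcomm q (e i) (e j)) :=
    (hi.mul_right hj).sub_right ((hj.mul_right hi).smul_right _)
  exact (hi.mul_right h1).sub_right ((h1.mul_right hi).smul_right _)

theorem commute_serre_short (hf : ChevalleyFamily q e f K K') (hq : q ≠ 0) {i j : Fin n}
    (hi0 : (i : ℕ) = 0) (hj1 : (j : ℕ) = 1) (k : Fin n) :
    Commute (f k) (qcomm 1 (e i) (qcomm q⁻¹ (e i) (qcomm q (e i) (e j)))) := by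
  obtain ⟨hij, hii, hr⟩ := rootForm_of_short hi0 hj1
  have hr' : rootForm j i = -1 := by rw [rootForm_comm, hr]
  have hi := hf.e_f i k
  have hj := hf.e_f j k
  rcases eq_or_ne i k with rfl | hik
  · simp only [if_true, hij.symm, if_false, add_zero] at hi hj
    refine commute_serre_short_left hq hi hj ?_ ?_ ?_ ?_
    · simpa [hii] using hf.K_e i i
    · simpa [hr] using hf.K_e i j
    · simpa [hii] using hf.K'_e hq i i
    · simpa [hr] using hf.K'_e hq i j
  rcases eq_or_ne j k with rfl | hjk
  · simp only [if_true, hij, if_false, add_zero] at hi hj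
    refine commute_serre_short_right hq hi hj ?_ ?_
    · simpa [hr'] using hf.K_e j i
    · simpa [hr'] using hf.K'_e hq j i
  simp only [hik, hjk, if_false, add_zero] at hi hj
  replace hi : Commute (f k) (e i) := hi.symm
  replace hj : Commute (f k) (e j) := hj.symm
  have h1 : Commute (f k) (qcomm q (e i) (e j)) :=
    (hi.mul_right hj).sub_right ((hj.mul_right hi).smul_right _)
  have h2 : Commute (f k) (qcomm q⁻¹ (e i) (qcomm q (e i) (e j))) :=
    (hi.mul_right h1).sub_right ((h1.mul_right hi).smul_right _)
  exact (hi.mul_right h2).sub_right ((h2.mul_right hi).smul_right _)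

theorem commute_comm (hf : ChevalleyFamily q e f K K') (hq : q ≠ 0) {i j : Fin n}
    (h : rootForm i j = 0) (k : Fin n) : Commute (f k) (qcomm 1 (e i) (e j)) := by
  have hij := ne_of_rootForm_eq_zero h
  have h' : rootForm j i = 0 := by rw [rootForm_comm, h]
  have hi := hf.e_f i k
  have hj := hf.e_f j k
  rcases eq_or_ne i k with rfl | hik
  · simp only [if_true, hij.symm, if_false, add_zero] at hi hj
    refine commute_qcomm_one hi hj ?_ ?_
    · simpa [h] using hf.K_e i j
    · simpa [h] using hf.K'_e hq i j
  rcases eq_or_ne j k with rfl | hjk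
  · simp only [if_true, hij, if_false, add_zero] at hi hj
    refine commute_qcomm_one' hi hj ?_ ?_
    · simpa [h'] using hf.K_e j i
    · simpa [h'] using hf.K'_e hq j i
  simp only [hik, hjk, if_false, add_zero] at hi hj
  replace hi : Commute (f k) (e i) := hi.symm
  replace hj : Commute (f k) (e j) := hj.symm
  exact (hi.mul_right hj).sub_right ((hj.mul_right hi).smul_right _)

end ChevalleyFamily

/-! ### The relations in the quotient algebra. -/

section Presentation

variable {n : ℕ} {q : ℂ}

theorem mkAlgHom_ι (x : Gen n) :
    RingQuot.mkAlgHom ℂ (Rel n q) (FreeAlgebra.ι ℂ x) = gen q x := rfl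

theorem chevalleyFamily_gen (n : ℕ) (q : ℂ) : ChevalleyFamily q (fun i : Fin n => gen q (Gen.e i))
    (fun i => gen q (Gen.f i)) (fun i => gen q (Gen.K i)) (fun i => gen q (Gen.Kinv i)) := by
  have h1 (i : Fin n) : gen q (Gen.K i) * gen q (Gen.Kinv i) = 1 := by
    simpa [mkAlgHom_ι] using RingQuot.mkAlgHom_rel ℂ (Rel.K_mul_Kinv (q := q) i)
  have h2 (i : Fin n) : gen q (Gen.Kinv i) * gen q (Gen.K i) = 1 := by
    simpa [mkAlgHom_ι] using RingQuot.mkAlgHom_rel ℂ (Rel.Kinv_mul_K (q := q) i)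
  have h3 {i : Fin n} {c : ℂ} {x : Uq n q}
      (h : gen q (Gen.K i) * x * gen q (Gen.Kinv i) = c • x) :
      gen q (Gen.K i) * x = c • (x * gen q (Gen.K i)) := by
    rw [← smul_mul_assoc, ← h, mul_assoc _ (gen q (Gen.Kinv i)), h2, mul_one]
  refine ⟨h1, h2, fun i j => ?_, fun i j => h3 ?_, fun i j => h3 ?_, fun i j => ?_⟩
  · simpa [mkAlgHom_ι] using RingQuot.mkAlgHom_rel ℂ (Rel.K_comm (q := q) i j)
  · simpa [mkAlgHom_ι] using RingQuot.mkAlgHom_rel ℂ (Rel.K_e (q := q) i j)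
  · simpa only [map_mul, map_smul, mkAlgHom_ι] using
      RingQuot.mkAlgHom_rel ℂ (Rel.K_f (q := q) i j)
  · have h := RingQuot.mkAlgHom_rel ℂ (Rel.e_f (q := q) i j)
    rw [← sub_eq_iff_eq_add']
    split_ifs at h ⊢ <;> simpa [mkAlgHom_ι, qcomm] using h

theorem adjoin_range_gen : Algebra.adjoin ℂ (Set.range (gen (n := n) q)) = ⊤ := by
  have h : Set.range (gen (n := n) q) =
      RingQuot.mkAlgHom ℂ (Rel n q) '' Set.range (FreeAlgebra.ι ℂ) := by
    rw [← Set.range_comp]; rfl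
  rw [h, ← AlgHom.map_adjoin, FreeAlgebra.adjoin_range_ι, Algebra.map_top, AlgHom.range_eq_top]
  exact RingQuot.mkAlgHom_surjective ℂ _

end Presentation

/-! ### Subspaces stable under multiplication by generators. -/

section Stable

variable {A : Type*} [Ring A] [Algebra ℂ A] {S : Set A} {P : Submodule ℂ A}

theorem mul_mem_of_left_stable (h : ∀ s ∈ S, ∀ x ∈ P, s * x ∈ P) {y : A}
    (hy : y ∈ Algebra.adjoin ℂ S) : ∀ x ∈ P, y * x ∈ P := by
  induction hy using Algebra.adjoin_induction with
  | mem s hs => exact h s hs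
  | algebraMap r => intro x hx; rw [← Algebra.smul_def]; exact P.smul_mem _ hx
  | add a b _ _ ha hb => intro x hx; rw [add_mul]; exact P.add_mem (ha x hx) (hb x hx)
  | mul a b _ _ ha hb => intro x hx; rw [mul_assoc]; exact ha _ (hb x hx)

theorem mul_mem_of_right_stable (h : ∀ s ∈ S, ∀ x ∈ P, x * s ∈ P) {y : A}
    (hy : y ∈ Algebra.adjoin ℂ S) : ∀ x ∈ P, x * y ∈ P := by
  induction hy using Algebra.adjoin_induction with
  | mem s hs => exact h s hs
  | algebraMap r =>
    intro x hx; rw [← Algebra.commutes, ← Algebra.smul_def]; exact P.smul_mem _ hx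
  | add a b _ _ ha hb => intro x hx; rw [mul_add]; exact P.add_mem (ha x hx) (hb x hx)
  | mul a b _ _ ha hb => intro x hx; rw [← mul_assoc]; exact hb _ (ha x hx)

theorem adjoin_le_of_left_stable (h1 : 1 ∈ P) (h : ∀ s ∈ S, ∀ x ∈ P, s * x ∈ P) :
    Subalgebra.toSubmodule (Algebra.adjoin ℂ S) ≤ P := fun y hy => by
  simpa using mul_mem_of_left_stable h hy 1 h1

theorem adjoin_le_of_right_stable (h1 : 1 ∈ P) (h : ∀ s ∈ S, ∀ x ∈ P, x * s ∈ P) :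
    Subalgebra.toSubmodule (Algebra.adjoin ℂ S) ≤ P := fun y hy => by
  simpa using mul_mem_of_right_stable h hy 1 h1

end Stable

/-! ### The Cartan subalgebra and the two ideals span. -/

section Span

variable {n : ℕ} {q : ℂ}

theorem gen_Kinv_mem_cartan (i : Fin n) : gen q (Gen.Kinv i) ∈ cartan n q :=
  Algebra.subset_adjoin (Or.inr ⟨i, rfl⟩)

/-- The right ideal generated by the `f_α`. -/
def lowerIdeal (n : ℕ) (q : ℂ) : Submodule ℂ (Uq n q) :=
  Submodule.span ℂ {y | ∃ (i : Fin n) (x : Uq n q), y = gen q (Gen.f i) * x}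

/-- The left ideal generated by the `e_α`. -/
def upperIdeal (n : ℕ) (q : ℂ) : Submodule ℂ (Uq n q) :=
  Submodule.span ℂ {y | ∃ (i : Fin n) (x : Uq n q), y = x * gen q (Gen.e i)}

theorem offCartan_eq : offCartan n q = lowerIdeal n q ⊔ upperIdeal n q := rfl

theorem lowerIdeal_mul {x : Uq n q} (hx : x ∈ lowerIdeal n q) (y : Uq n q) :
    x * y ∈ lowerIdeal n q := by
  induction hx using Submodule.span_induction with
  | mem x h =>
    obtain ⟨i, z, rfl⟩ := h
    exact Submodule.subset_span ⟨i, z * y, by rw [mul_assoc]⟩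
  | zero => simp
  | add a b _ _ ha hb => rw [add_mul]; exact add_mem ha hb
  | smul c a _ ha => rw [smul_mul_assoc]; exact Submodule.smul_mem _ _ ha

theorem mul_upperIdeal {x : Uq n q} (hx : x ∈ upperIdeal n q) (y : Uq n q) :
    y * x ∈ upperIdeal n q := by
  induction hx using Submodule.span_induction with
  | mem x h =>
    obtain ⟨i, z, rfl⟩ := h
    exact Submodule.subset_span ⟨i, y * z, by rw [mul_assoc]⟩
  | zero => simp
  | add a b _ _ ha hb => rw [mul_add]; exact add_mem ha hb
  | smul c a _ ha => rw [mul_smul_comm]; exact Submodule.smul_mem _ _ ha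

/-- Each `e_α` commutes with `q^{± h_β}` up to a nonzero scalar, so this left ideal is stable under
right multiplication by the Cartan subalgebra. -/
theorem gen_e_mul_mem_upperIdeal (hq : q ≠ 0) (i : Fin n) {x : Uq n q} (hx : x ∈ cartan n q) :
    gen q (Gen.e i) * x ∈ upperIdeal n q := by
  have hf := chevalleyFamily_gen n q
  have hx' := mul_mem_of_right_stable (P := upperIdeal n q) ?_ hx (gen q (Gen.e i))
    (Submodule.subset_span ⟨i, 1, by simp⟩)
  · exact hx'
  have key {k : Uq n q} {j : Fin n} {c : ℂ} (hc : c ≠ 0)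
      (h : k * gen q (Gen.e j) = c • (gen q (Gen.e j) * k)) (z : Uq n q) :
      z * gen q (Gen.e j) * k ∈ upperIdeal n q := by
    have h' : gen q (Gen.e j) * k = c⁻¹ • (k * gen q (Gen.e j)) := by
      rw [h, smul_smul, inv_mul_cancel₀ hc, one_smul]
    rw [mul_assoc, h', mul_smul_comm, ← mul_assoc]
    exact Submodule.smul_mem _ _ (Submodule.subset_span ⟨j, _, rfl⟩)
  rintro s hs x hx
  induction hx using Submodule.span_induction with
  | mem x h =>
    obtain ⟨j, z, rfl⟩ := h
    rcases hs with ⟨k, rfl⟩ | ⟨k, rfl⟩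
    · exact key (zpow_ne_zero _ hq) (hf.K_e k j) z
    · exact key (zpow_ne_zero _ hq) (hf.K'_e hq k j) z
  | zero => simp
  | add a b _ _ ha hb => rw [add_mul]; exact add_mem ha hb
  | smul c a _ ha => rw [smul_mul_assoc]; exact Submodule.smul_mem _ _ ha

/-- The subalgebra generated by the `q^{± h_α}` and the `e_α`. -/
def borel (n : ℕ) (q : ℂ) : Subalgebra ℂ (Uq n q) :=
  Algebra.adjoin ℂ (Set.range (fun i : Fin n => gen q (Gen.K i)) ∪
    Set.range (fun i => gen q (Gen.Kinv i)) ∪ Set.range (fun i => gen q (Gen.e i)))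

theorem borel_le (hq : q ≠ 0) :
    Subalgebra.toSubmodule (borel n q) ≤
      Subalgebra.toSubmodule (cartan n q) ⊔ upperIdeal n q := by
  refine adjoin_le_of_left_stable (Submodule.mem_sup_left (one_mem (cartan n q))) ?_
  intro s hs x hx
  obtain ⟨a, ha, b, hb, rfl⟩ := Submodule.mem_sup.1 hx
  rw [mul_add]
  refine add_mem ?_ (Submodule.mem_sup_right (mul_upperIdeal hb s))
  rcases hs with hs | ⟨i, rfl⟩
  · exact Submodule.mem_sup_left (Subalgebra.mul_mem _ (Algebra.subset_adjoin hs) ha)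
  · exact Submodule.mem_sup_right (gen_e_mul_mem_upperIdeal hq i ha)

theorem borel_sup_lowerIdeal (hq : q ≠ 0) :
    Subalgebra.toSubmodule (borel n q) ⊔ lowerIdeal n q = ⊤ := by
  have hf := chevalleyFamily_gen n q
  set P := Subalgebra.toSubmodule (borel n q) ⊔ lowerIdeal n q with hP
  have hK (i : Fin n) : gen q (Gen.K i) ∈ borel n q :=
    Algebra.subset_adjoin (Or.inl (Or.inl ⟨i, rfl⟩))
  have hK' (i : Fin n) : gen q (Gen.Kinv i) ∈ borel n q :=
    Algebra.subset_adjoin (Or.inl (Or.inr ⟨i, rfl⟩))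
  have he (i : Fin n) : gen q (Gen.e i) ∈ borel n q := Algebra.subset_adjoin (Or.inr ⟨i, rfl⟩)
  have hPb {x b : Uq n q} (hx : x ∈ P) (hb : b ∈ borel n q) : x * b ∈ P := by
    obtain ⟨a, ha, c, hc, rfl⟩ := Submodule.mem_sup.1 hx
    rw [add_mul]
    exact add_mem (Submodule.mem_sup_left (Subalgebra.mul_mem _ ha hb))
      (Submodule.mem_sup_right (lowerIdeal_mul hc b))
  -- The elements `b` of the Borel part with `b f_i ∈ P` for all `i` at once form a subspace stable
  -- under right multiplication by the Borel generators; membership of `b` itself is kept for the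
  -- Cartan term of `[e_i, f_j]`.
  have hbf : Subalgebra.toSubmodule (borel n q) ≤ Subalgebra.toSubmodule (borel n q) ⊓
      ⨅ i : Fin n, P.comap (LinearMap.mulRight ℂ (gen q (Gen.f i))) := by
    refine adjoin_le_of_right_stable ?_ ?_
    · refine ⟨one_mem (borel n q), ?_⟩
      simp only [SetLike.mem_coe, Submodule.mem_iInf, Submodule.mem_comap,
        LinearMap.mulRight_apply, one_mul]
      exact fun i => Submodule.mem_sup_right (Submodule.subset_span ⟨i, 1, by simp⟩)
    · rintro s hs x ⟨hx, hxf⟩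
      simp only [SetLike.mem_coe, Submodule.mem_iInf, Submodule.mem_comap,
        LinearMap.mulRight_apply] at hxf
      have hsB : s ∈ borel n q := Algebra.subset_adjoin hs
      refine ⟨Subalgebra.mul_mem _ hx hsB, ?_⟩
      simp only [SetLike.mem_coe, Submodule.mem_iInf, Submodule.mem_comap,
        LinearMap.mulRight_apply]
      intro j
      rw [mul_assoc]
      rcases hs with (⟨i, rfl⟩ | ⟨i, rfl⟩) | ⟨i, rfl⟩
      · rw [hf.K_f i j, mul_smul_comm, ← mul_assoc]
        exact P.smul_mem _ (hPb (hxf j) (hK i))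
      · rw [hf.K'_f hq i j, mul_smul_comm, ← mul_assoc]
        exact P.smul_mem _ (hPb (hxf j) (hK' i))
      · rw [hf.e_f i j, mul_add, ← mul_assoc]
        refine add_mem (hPb (hxf j) (he i)) (Submodule.mem_sup_left (Subalgebra.mul_mem _ hx ?_))
        split_ifs
        · exact Subalgebra.smul_mem _ (sub_mem (hK i) (hK' i)) _
        · exact zero_mem _
  have h : Subalgebra.toSubmodule (Algebra.adjoin ℂ (Set.range (gen (n := n) q))) ≤ P := by
    refine adjoin_le_of_right_stable (Submodule.mem_sup_left (one_mem (borel n q))) ?_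
    rintro s ⟨g, rfl⟩ x hx
    cases g with
    | K i => exact hPb hx (hK i)
    | Kinv i => exact hPb hx (hK' i)
    | e i => exact hPb hx (he i)
    | f i =>
      obtain ⟨a, ha, c, hc, rfl⟩ := Submodule.mem_sup.1 hx
      rw [add_mul]
      refine add_mem ?_ (Submodule.mem_sup_right (lowerIdeal_mul hc _))
      have := (hbf ha).2
      simp only [SetLike.mem_coe, Submodule.mem_iInf, Submodule.mem_comap,
        LinearMap.mulRight_apply] at this
      exact this i
  rw [adjoin_range_gen] at h
  exact top_le_iff.1 (by simpa using h)

theorem cartan_sup_offCartan (hq : q ≠ 0) :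
    Subalgebra.toSubmodule (cartan n q) ⊔ offCartan n q = ⊤ := by
  rw [← top_le_iff, ← borel_sup_lowerIdeal hq, offCartan_eq]
  refine sup_le ((borel_le hq).trans ?_) (le_sup_left.trans le_sup_right)
  exact sup_le_sup_left le_sup_right _

end Span

/-! ### The free highest weight module on words and its vacuum functionals. -/

section Verma

variable {n : ℕ} {q : ℂ} {R : Type*} [CommRing R]

theorem end_ext {ι : Type*} {A B : Module.End R (ι →₀ R)}
    (h : ∀ w, A (Finsupp.single w 1) = B (Finsupp.single w 1)) : A = B :=
  Finsupp.lhom_ext' fun w => LinearMap.ext_ring (h w)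

/-- The diagonal operator with given eigenvalues. -/
def diagonalEnd {ι : Type*} (d : ι → R) : Module.End R (ι →₀ R) :=
  Finsupp.linearCombination R fun w => d w • Finsupp.single w 1

theorem diagonalEnd_single {ι : Type*} (d : ι → R) (w : ι) :
    diagonalEnd d (Finsupp.single w 1) = d w • Finsupp.single w 1 := by
  simp [diagonalEnd]

/-- The pairing of `αᵢ` with the sum of the simple roots in a word. -/
def wordForm (i : Fin n) (w : List (Fin n)) : ℤ := (w.map (rootForm i)).sum

theorem wordForm_cons (i j : Fin n) (w : List (Fin n)) :
    wordForm i (j :: w) = rootForm i j + wordForm i w := by simp [wordForm]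

/-- Left multiplication by `f_α` on words. -/
def vermaF (R : Type*) [CommRing R] (i : Fin n) : Module.End R (List (Fin n) →₀ R) :=
  Finsupp.lmapDomain R R (List.cons i)

theorem vermaF_single (i : Fin n) (w : List (Fin n)) :
    vermaF R i (Finsupp.single w 1) = Finsupp.single (i :: w) 1 := by
  simp [vermaF, Finsupp.mapDomain_single]

variable [Algebra ℂ R]

/-- The operator by which `q^{h_α}` acts on words, for highest weight `c`. -/
def vermaK (q : ℂ) (c : Fin n → R) (i : Fin n) : Module.End R (List (Fin n) →₀ R) :=
  diagonalEnd fun w => q ^ (-wordForm i w) • c i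

/-- The image of a word under `e_α`. -/
def vermaEWord (q : ℂ) (c c' : Fin n → R) (i : Fin n) : List (Fin n) → (List (Fin n) →₀ R)
  | [] => 0
  | j :: w => vermaF R j (vermaEWord q c c' i w) + if i = j then
      (q - q⁻¹)⁻¹ • (vermaK q c i (Finsupp.single w 1) - vermaK q⁻¹ c' i (Finsupp.single w 1))
      else 0

/-- The operator by which `e_α` acts on words. -/
def vermaE (q : ℂ) (c c' : Fin n → R) (i : Fin n) : Module.End R (List (Fin n) →₀ R) :=
  Finsupp.linearCombination R (vermaEWord q c c' i)

theorem vermaE_single (c c' : Fin n → R) (i : Fin n) (w : List (Fin n)) :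
    vermaE q c c' i (Finsupp.single w 1) = vermaEWord q c c' i w := by
  simp [vermaE]

theorem vermaE_nil (c c' : Fin n → R) (i : Fin n) :
    vermaE q c c' i (Finsupp.single [] 1) = 0 := by
  rw [vermaE_single, vermaEWord]

theorem vermaK_single (c : Fin n → R) (i : Fin n) (w : List (Fin n)) :
    vermaK q c i (Finsupp.single w 1) = (q ^ (-wordForm i w) • c i) • Finsupp.single w 1 :=
  diagonalEnd_single _ _

theorem vermaK_mul_vermaF (hq : q ≠ 0) (c : Fin n → R) (i j : Fin n) :
    vermaK q c i * vermaF R j = q ^ (-rootForm i j) • (vermaF R j * vermaK q c i) := by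
  refine end_ext fun w => ?_
  simp only [Module.End.mul_apply, vermaF_single, vermaK_single, LinearMap.smul_apply,
    LinearMap.map_smul_of_tower, map_smul, wordForm_cons, neg_add, zpow_add₀ hq, mul_smul,
    smul_assoc]

/-- The relation `e_f` is built into the recursion for `vermaEWord`. Only `K_e` needs an induction
on words: removing a letter changes the weight by exactly the root of that letter. -/
theorem chevalleyFamily_verma (hq : q ≠ 0) (c c' : Fin n → R) (hc : ∀ i, c i * c' i = 1) :
    ChevalleyFamily q (vermaE q c c') (vermaF R) (vermaK q c) (vermaK q⁻¹ c') where
  K_mul i := end_ext fun w => by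
    simp only [Module.End.mul_apply, vermaK_single, map_smul, smul_smul, Module.End.one_apply]
    rw [smul_mul_smul_comm, mul_comm (c' i), hc, inv_zpow, inv_mul_cancel₀ (zpow_ne_zero _ hq),
      one_smul, one_smul]
  mul_K i := end_ext fun w => by
    simp only [Module.End.mul_apply, vermaK_single, map_smul, smul_smul, Module.End.one_apply]
    rw [smul_mul_smul_comm, hc, inv_zpow, mul_inv_cancel₀ (zpow_ne_zero _ hq),
      one_smul, one_smul]
  K_comm i j := end_ext fun w => by
    simp only [Module.End.mul_apply, vermaK_single, map_smul, smul_smul]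
    rw [mul_comm]
  K_f := vermaK_mul_vermaF hq c
  e_f i j := end_ext fun w => by
    simp only [Module.End.mul_apply, vermaF_single, vermaE_single, vermaEWord,
      LinearMap.add_apply]
    congr 1
    split_ifs <;> simp
  K_e i j := end_ext fun w => by
    simp only [Module.End.mul_apply, vermaE_single, vermaK_single, LinearMap.smul_apply, map_smul]
    induction w with
    | nil => simp [vermaEWord]
    | cons k w ih =>
      have hF := congrArg (fun T => T (vermaEWord q c c' j w)) (vermaK_mul_vermaF hq c i k)
      simp only [Module.End.mul_apply, LinearMap.smul_apply] at hF
      simp only [vermaEWord, map_add, hF, ih, wordForm_cons, neg_add, zpow_add₀ hq, smul_add]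
      have h1 : q ^ rootForm i k * q ^ (-rootForm i k) = 1 := by
        rw [zpow_neg, mul_inv_cancel₀ (zpow_ne_zero _ hq)]
      congr 1
      · rw [LinearMap.map_smul_of_tower, map_smul]
        generalize vermaF R k _ = v
        rw [mul_smul (q ^ (-rootForm i k)), smul_assoc (q ^ (-rootForm i k)),
          smul_comm (q ^ rootForm i j) (q ^ (-rootForm i k))]
      · rcases eq_or_ne j k with rfl | hjk
        · obtain ⟨r, hr⟩ : ∃ r : R, (q - q⁻¹)⁻¹ • (vermaK q c j (Finsupp.single w 1) -
              vermaK q⁻¹ c' j (Finsupp.single w 1)) = r • Finsupp.single w 1 := by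
            simp only [vermaK_single, ← sub_smul, ← smul_assoc]
            exact ⟨_, rfl⟩
          rw [if_pos rfl, hr, map_smul, vermaK_single, mul_smul (q ^ (-rootForm i j)),
            smul_assoc (q ^ (-rootForm i j)), smul_smul (q ^ rootForm i j), h1, one_smul, smul_comm]
        · simp [hjk]

-- The vacuum generates the module under the `f_α`, so an operator commuting with all of them is
-- determined by its value on the vacuum.
omit [Algebra ℂ R] in
theorem eq_zero_of_commute_vermaF {S : Module.End R (List (Fin n) →₀ R)}
    (hS : ∀ k, Commute (vermaF R k) S) (h0 : S (Finsupp.single [] 1) = 0) : S = 0 :=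
  end_ext fun w => by
    induction w with
    | nil => simpa using h0
    | cons k w ih =>
      have h := congrArg (fun T => T (Finsupp.single w 1)) (hS k).eq
      simp only [Module.End.mul_apply, vermaF_single] at h
      rw [← h, ih]
      simp

/-- The functionals obtained from the coefficient of the vacuum by composing with words in the
`e_α`. -/
def upperFunctionals (q : ℂ) (c c' : Fin n → R) :
    Submodule R (Module.Dual R (List (Fin n) →₀ R)) :=
  Submodule.span R (Set.range fun w : List (Fin n) =>
    Finsupp.lapply ([] : List (Fin n)) ∘ₗ (w.map (vermaE q c c')).prod)

omit [Algebra ℂ R] in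
theorem lapply_nil_vermaF (i : Fin n) (v : List (Fin n) →₀ R) : (vermaF R i v) [] = 0 := by
  simp only [vermaF, Finsupp.lmapDomain_apply]
  exact Finsupp.mapDomain_of_notMem_range _ _ (by simp)

theorem lapply_nil_vermaK (c : Fin n → R) (i : Fin n) :
    Finsupp.lapply [] ∘ₗ vermaK q c i = c i • Finsupp.lapply (M := R) [] := by
  refine Finsupp.lhom_ext' fun w => LinearMap.ext_ring ?_
  rcases eq_or_ne w [] with rfl | hw
  · simp [vermaK_single, wordForm]
  · simp [vermaK_single, hw]

theorem comp_vermaE_mem {c c' : Fin n → R} {ψ : Module.Dual R (List (Fin n) →₀ R)}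
    (hψ : ψ ∈ upperFunctionals q c c') (i : Fin n) :
    ψ ∘ₗ vermaE q c c' i ∈ upperFunctionals q c c' := by
  induction hψ using Submodule.span_induction with
  | mem x h =>
    obtain ⟨w, rfl⟩ := h
    refine Submodule.subset_span ⟨w ++ [i], ?_⟩
    simp [List.prod_append, Module.End.mul_eq_comp, LinearMap.comp_assoc]
  | zero => simp
  | add a b _ _ ha hb => rw [LinearMap.add_comp]; exact add_mem ha hb
  | smul r a _ ha => rw [LinearMap.smul_comp]; exact Submodule.smul_mem _ _ ha

theorem smul_mem_upperFunctionals {c c' : Fin n → R} {ψ : Module.Dual R (List (Fin n) →₀ R)}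
    (hψ : ψ ∈ upperFunctionals q c c') (a : ℂ) : a • ψ ∈ upperFunctionals q c c' := by
  rw [← algebraMap_smul R]
  exact Submodule.smul_mem _ _ hψ

theorem comp_mem_of_words {c c' : Fin n → R} {T : Module.End R (List (Fin n) →₀ R)}
    (hT : ∀ w : List (Fin n), Finsupp.lapply ([] : List (Fin n)) ∘ₗ
      ((w.map (vermaE q c c')).prod * T) ∈ upperFunctionals q c c')
    {ψ : Module.Dual R (List (Fin n) →₀ R)} (hψ : ψ ∈ upperFunctionals q c c') :
    ψ ∘ₗ T ∈ upperFunctionals q c c' := by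
  induction hψ using Submodule.span_induction with
  | mem x h =>
    obtain ⟨w, rfl⟩ := h
    exact hT w
  | zero => simp
  | add a b _ _ ha hb => rw [LinearMap.add_comp]; exact add_mem ha hb
  | smul r a _ ha => rw [LinearMap.smul_comp]; exact Submodule.smul_mem _ _ ha

/-- Move `T` leftwards through the word, starting at the last letter, until it meets the vacuum
functional, where `h0` applies. The correction terms `S` stay in the span by assumption. -/
theorem word_comp_mem_of_smul_commute {c c' : Fin n → R} {T : Module.End R (List (Fin n) →₀ R)}
    (h0 : Finsupp.lapply ([] : List (Fin n)) ∘ₗ T ∈ upperFunctionals q c c')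
    (hT : ∀ i, ∃ a : ℂ, ∃ S : Module.End R (List (Fin n) →₀ R),
      (∀ ψ ∈ upperFunctionals q c c', ψ ∘ₗ S ∈ upperFunctionals q c c') ∧
      vermaE q c c' i * T = a • (T * vermaE q c c' i) + S) (w : List (Fin n)) :
    Finsupp.lapply ([] : List (Fin n)) ∘ₗ
      ((w.map (vermaE q c c')).prod * T) ∈ upperFunctionals q c c' := by
  induction w using List.reverseRecOn with
  | nil => simpa using h0
  | append_singleton w i ih =>
    obtain ⟨a, S, hS, h⟩ := hT i
    have hw : Finsupp.lapply ([] : List (Fin n)) ∘ₗ (w.map (vermaE q c c')).prod ∈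
      upperFunctionals q c c' := Submodule.subset_span ⟨w, rfl⟩
    have key : Finsupp.lapply ([] : List (Fin n)) ∘ₗ
        (((w ++ [i]).map (vermaE q c c')).prod * T) =
        a • ((Finsupp.lapply ([] : List (Fin n)) ∘ₗ
          ((w.map (vermaE q c c')).prod * T)) ∘ₗ vermaE q c c' i) +
        (Finsupp.lapply ([] : List (Fin n)) ∘ₗ (w.map (vermaE q c c')).prod) ∘ₗ S := by
      rw [List.map_append, List.prod_append, List.map_singleton, List.prod_singleton, mul_assoc, h,
        mul_add, mul_smul_comm, ← mul_assoc]
      rfl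
    rw [key]
    exact add_mem (smul_mem_upperFunctionals (comp_vermaE_mem ih i) a) (hS _ hw)

theorem comp_vermaK_mem (hq : q ≠ 0) {c c' : Fin n → R} (hc : ∀ i, c i * c' i = 1)
    {ψ : Module.Dual R (List (Fin n) →₀ R)} (hψ : ψ ∈ upperFunctionals q c c') (i : Fin n) :
    ψ ∘ₗ vermaK q c i ∈ upperFunctionals q c c' ∧
      ψ ∘ₗ vermaK q⁻¹ c' i ∈ upperFunctionals q c c' := by
  have hf := chevalleyFamily_verma hq c c' hc
  have h1 : Finsupp.lapply (M := R) ([] : List (Fin n)) ∈ upperFunctionals q c c' :=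
    Submodule.subset_span ⟨[], rfl⟩
  have move {T : Module.End R (List (Fin n) →₀ R)} {j : Fin n} {a : ℂ} (ha : a ≠ 0)
      (h : T * vermaE q c c' j = a • (vermaE q c c' j * T)) :
      vermaE q c c' j * T = a⁻¹ • (T * vermaE q c c' j) + 0 := by
    rw [h, smul_smul, inv_mul_cancel₀ ha, one_smul, add_zero]
  constructor
  · refine comp_mem_of_words (word_comp_mem_of_smul_commute ?_ fun j => ⟨_, 0, by simp,
      move (zpow_ne_zero _ hq) (hf.K_e i j)⟩) hψ
    rw [lapply_nil_vermaK]
    exact Submodule.smul_mem _ _ h1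
  · refine comp_mem_of_words (word_comp_mem_of_smul_commute ?_ fun j => ⟨_, 0, by simp,
      move (zpow_ne_zero _ hq) (hf.K'_e hq i j)⟩) hψ
    rw [lapply_nil_vermaK]
    exact Submodule.smul_mem _ _ h1

theorem comp_vermaF_mem (hq : q ≠ 0) {c c' : Fin n → R} (hc : ∀ i, c i * c' i = 1)
    {ψ : Module.Dual R (List (Fin n) →₀ R)} (hψ : ψ ∈ upperFunctionals q c c') (j : Fin n) :
    ψ ∘ₗ vermaF R j ∈ upperFunctionals q c c' := by
  have hf := chevalleyFamily_verma hq c c' hc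
  refine comp_mem_of_words (word_comp_mem_of_smul_commute ?_ fun i => ⟨1, _, ?_,
    (hf.e_f i j).trans (by rw [one_smul])⟩) hψ
  · rw [show Finsupp.lapply ([] : List (Fin n)) ∘ₗ vermaF R j = 0 from
      LinearMap.ext fun v => lapply_nil_vermaF j v]
    exact zero_mem _
  · intro ψ hψ
    split_ifs
    · have h := comp_vermaK_mem hq hc hψ i
      rw [LinearMap.comp_smul, LinearMap.comp_sub]
      exact smul_mem_upperFunctionals (sub_mem h.1 h.2) _
    · simp

/-- Dual to `eq_zero_of_commute_vermaF`: `S` passes through the `e_α` until it stands next to the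
vacuum functional, which annihilates its range. The operator `S` itself need not vanish. -/
theorem comp_eq_zero_of_commute_vermaE {c c' : Fin n → R}
    {S : Module.End R (List (Fin n) →₀ R)} (hS : ∀ k, Commute (vermaE q c c' k) S)
    (h0 : ∀ v, S v [] = 0) {ψ : Module.Dual R (List (Fin n) →₀ R)}
    (hψ : ψ ∈ upperFunctionals q c c') : ψ ∘ₗ S = 0 := by
  induction hψ using Submodule.span_induction with
  | mem x h =>
    obtain ⟨w, rfl⟩ := h
    have hw : Commute (w.map (vermaE q c c')).prod S :=
      Commute.list_prod_left _ _ fun x hx => by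
        obtain ⟨k, _, rfl⟩ := List.mem_map.1 hx
        exact hS k
    rw [LinearMap.comp_assoc, ← Module.End.mul_eq_comp, hw.eq]
    exact LinearMap.ext fun v => h0 _
  | zero => simp
  | add a b _ _ ha hb => rw [LinearMap.add_comp, ha, hb, add_zero]
  | smul r a _ ha => rw [LinearMap.smul_comp, ha, smul_zero]

end Verma

/-! ### Descent of the vacuum coefficient to the quantum group. -/

section Functional

open FreeAlgebra

/-- Being indistinguishable by `Φ` under all two-sided multiplications is a ring congruence. It
contains `r`, so `RingQuot r` maps onto its quotient, and `Φ` factors through the latter. -/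
theorem exists_ringQuot_functional {A M : Type*} [Ring A] [Algebra ℂ A] [AddCommGroup M]
    [Module ℂ M] {r : A → A → Prop} (Φ : A →ₗ[ℂ] M)
    (h : ∀ x y, r x y → ∀ a b, Φ (a * x * b) = Φ (a * y * b)) :
    ∃ Ψ : RingQuot r →ₗ[ℂ] M, ∀ x, Ψ (RingQuot.mkAlgHom ℂ r x) = Φ x := by
  let s : RingCon A :=
    { r := fun x y => ∀ a b, Φ (a * x * b) = Φ (a * y * b)
      iseqv := ⟨fun _ _ _ => rfl, fun h a b => (h a b).symm,
        fun h h' a b => (h a b).trans (h' a b)⟩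
      add' := fun h h' a b => by
        simp only [mul_add, add_mul, map_add, h a b, h' a b]
      mul' := fun {w x y z} h h' a b => by
        have h1 := h a (y * b)
        have h2 := h' (a * x) b
        simp only [mul_assoc] at *
        rw [h1, h2] }
  have hs {x y : A} (hxy : s x y) : Φ x = Φ y := by simpa using hxy 1 1
  have hker : LinearMap.ker (RingQuot.mkAlgHom ℂ r).toLinearMap ≤ LinearMap.ker Φ := by
    intro x hx
    have h1 := RingQuot.liftAlgHom_mkAlgHom_apply ℂ (s.mkₐ (α := ℂ)) (s := r)
      (fun x y hxy => (RingCon.eq s).2 (h x y hxy)) x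
    rw [show RingQuot.mkAlgHom ℂ r x = 0 from hx, map_zero] at h1
    have h2 : s x 0 := (RingCon.eq s).1 (by simpa using h1.symm)
    simpa using hs h2
  have hsurj : Function.Surjective (RingQuot.mkAlgHom ℂ r).toLinearMap :=
    RingQuot.mkAlgHom_surjective ℂ r
  refine ⟨(LinearMap.ker (RingQuot.mkAlgHom ℂ r).toLinearMap).liftQ Φ hker ∘ₗ
    ((RingQuot.mkAlgHom ℂ r).toLinearMap.quotKerEquivOfSurjective hsurj).symm.toLinearMap,
    fun x => ?_⟩
  have : ((RingQuot.mkAlgHom ℂ r).toLinearMap.quotKerEquivOfSurjective hsurj).symm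
      (RingQuot.mkAlgHom ℂ r x) = Submodule.Quotient.mk x := by
    rw [LinearEquiv.symm_apply_eq]; rfl
  simp [this]

variable {n : ℕ} {q : ℂ} {R : Type*} [CommRing R] [Algebra ℂ R]

/-- The images of the generators in an algebra with elements `e`, `f`, `K`, `K'`. -/
def genImage {A : Type*} (e f K K' : Fin n → A) : Gen n → A
  | Gen.K i => K i
  | Gen.Kinv i => K' i
  | Gen.e i => e i
  | Gen.f i => f i

/-- A functional on `U_q(so(2n+1))` that kills `g₋ U` and `U g₊`, and under which the Cartan
subalgebra acts with weight `c`. -/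
structure IsHighestWeightFunctional (Φ : Uq n q →ₗ[ℂ] R) (c c' : Fin n → R) : Prop where
  map_one : Φ 1 = 1
  f_mul (i x) : Φ (gen q (Gen.f i) * x) = 0
  mul_e (i x) : Φ (x * gen q (Gen.e i)) = 0
  K_mul (i x) : Φ (gen q (Gen.K i) * x) = c i * Φ x
  Kinv_mul (i x) : Φ (gen q (Gen.Kinv i) * x) = c' i * Φ x

theorem exists_isHighestWeightFunctional (hq : q ≠ 0) (c c' : Fin n → R)
    (hc : ∀ i, c i * c' i = 1) :
    ∃ Φ : Uq n q →ₗ[ℂ] R, IsHighestWeightFunctional Φ c c' := by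
  have hf := chevalleyFamily_verma hq c c' hc
  have hf' := hf.symm hq
  let ρ : FreeAlgebra ℂ (Gen n) →ₐ[ℂ] Module.End R (List (Fin n) →₀ R) :=
    FreeAlgebra.lift ℂ (genImage (vermaE q c c') (vermaF R) (vermaK q c) (vermaK q⁻¹ c'))
  have hρe (i) : ρ (ι ℂ (Gen.e i)) = vermaE q c c' i := FreeAlgebra.lift_ι_apply _ _
  have hρf (i) : ρ (ι ℂ (Gen.f i)) = vermaF R i := FreeAlgebra.lift_ι_apply _ _
  have hρK (i) : ρ (ι ℂ (Gen.K i)) = vermaK q c i := FreeAlgebra.lift_ι_apply _ _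
  have hρK' (i) : ρ (ι ℂ (Gen.Kinv i)) = vermaK q⁻¹ c' i := FreeAlgebra.lift_ι_apply _ _
  have hρq (a : ℂ) (x y) : ρ (qcomm a x y) = qcomm a (ρ x) (ρ y) := by simp [qcomm]
  -- An arbitrary left factor `a` turns the vacuum functional into another element of this span, so
  -- `f`-Serre elements vanish in the middle of any product.
  have hstable (a : FreeAlgebra ℂ (Gen n)) : ∀ ψ ∈ upperFunctionals q c c',
      ψ ∘ₗ ρ a ∈ upperFunctionals q c c' := by
    induction a using FreeAlgebra.induction with
    | grade0 r =>
      intro ψ hψ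
      rw [AlgHom.commutes, Algebra.algebraMap_eq_smul_one, LinearMap.comp_smul]
      exact smul_mem_upperFunctionals hψ r
    | grade1 x =>
      intro ψ hψ
      cases x with
      | K i => rw [hρK]; exact (comp_vermaK_mem hq hc hψ i).1
      | Kinv i => rw [hρK']; exact (comp_vermaK_mem hq hc hψ i).2
      | e i => rw [hρe]; exact comp_vermaE_mem hψ i
      | f i => rw [hρf]; exact comp_vermaF_mem hq hc hψ i
    | mul a b ha hb =>
      intro ψ hψ
      rw [map_mul, Module.End.mul_eq_comp, ← LinearMap.comp_assoc]
      exact hb _ (ha _ hψ)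
    | add a b ha hb =>
      intro ψ hψ
      rw [map_add, LinearMap.comp_add]
      exact add_mem (ha _ hψ) (hb _ hψ)
  have hvac : Finsupp.lapply (M := R) ([] : List (Fin n)) ∈ upperFunctionals q c c' :=
    Submodule.subset_span ⟨[], rfl⟩
  let Φ₀ : FreeAlgebra ℂ (Gen n) →ₗ[ℂ] R :=
    { toFun := fun x => ρ x (Finsupp.single [] 1) []
      map_add' := fun x y => by simp
      map_smul' := fun r x => by simp }
  have hΦ₀ (x) : Φ₀ x = ρ x (Finsupp.single [] 1) [] := rfl
  have of_eq {x y : FreeAlgebra ℂ (Gen n)} (h : ρ x = ρ y) (a b : FreeAlgebra ℂ (Gen n)) :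
      Φ₀ (a * x * b) = Φ₀ (a * y * b) := by
    simp only [hΦ₀, map_mul, h]
  have of_e {x : FreeAlgebra ℂ (Gen n)} (h : ∀ k, Commute (vermaF R k) (ρ x))
      (h0 : ρ x (Finsupp.single [] 1) = 0) (a b : FreeAlgebra ℂ (Gen n)) :
      Φ₀ (a * x * b) = Φ₀ (a * 0 * b) :=
    of_eq (by rw [map_zero]; exact eq_zero_of_commute_vermaF h h0) a b
  have of_f {x : FreeAlgebra ℂ (Gen n)} (h : ∀ k, Commute (vermaE q c c' k) (ρ x))
      (h0 : ∀ v, ρ x v [] = 0) (a b : FreeAlgebra ℂ (Gen n)) :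
      Φ₀ (a * x * b) = Φ₀ (a * 0 * b) := by
    have h1 := congrArg (fun T => T (ρ b (Finsupp.single [] 1)))
      (comp_eq_zero_of_commute_vermaE h h0 (hstable a _ hvac))
    simpa [hΦ₀] using h1
  obtain ⟨Φ, hΦ⟩ := exists_ringQuot_functional (r := Rel n q) Φ₀ (by
    intro x y hxy
    cases hxy with
    | K_mul_Kinv i => exact of_eq (by simp [hρK, hρK', hf.K_mul])
    | Kinv_mul_K i => exact of_eq (by simp [hρK, hρK', hf.mul_K])
    | K_comm i j => exact of_eq (by simp [hρK, hf.K_comm i j])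
    | K_e i j =>
      exact of_eq (by rw [map_mul, map_mul, map_smul, hρK, hρK', hρe, hf.K_e i j, smul_mul_assoc,
        mul_assoc, hf.K_mul, mul_one])
    | K_f i j =>
      exact of_eq (by rw [map_mul, map_mul, map_smul, hρK, hρK', hρf, hf.K_f i j, smul_mul_assoc,
        mul_assoc, hf.K_mul, mul_one])
    | e_f i j =>
      refine of_eq ?_
      rw [hρq, hρe, hρf]
      refine (hf.qcomm_e_f i j).trans ?_
      split_ifs <;> simp [hρK, hρK']
    | serre_e i j h =>
      refine of_e ?_ ?_ <;> simp only [hρq, hρe]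
      · exact hf.commute_serre hq h
      · simp [qcomm, vermaE_nil]
    | serre_f i j h =>
      refine of_f ?_ ?_ <;> simp only [hρq, hρf]
      · exact hf'.commute_serre hq h
      · simp [qcomm, lapply_nil_vermaF]
    | serre_short_e i j hi hj =>
      refine of_e ?_ ?_ <;> simp only [hρq, hρe]
      · exact hf.commute_serre_short hq hi hj
      · simp [qcomm, vermaE_nil]
    | serre_short_f i j hi hj =>
      refine of_f ?_ ?_ <;> simp only [hρq, hρf]
      · exact hf'.commute_serre_short hq hi hj
      · simp [qcomm, lapply_nil_vermaF]
    | e_comm i j h =>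
      refine of_e ?_ ?_ <;> simp only [hρq, hρe]
      · exact hf.commute_comm hq h
      · simp [qcomm, vermaE_nil]
    | f_comm i j h =>
      refine of_f ?_ ?_ <;> simp only [hρq, hρf]
      · exact hf'.commute_comm hq h
      · simp [qcomm, lapply_nil_vermaF])
  have hsurj := RingQuot.mkAlgHom_surjective ℂ (Rel n q)
  refine ⟨Φ, ?_, fun i x => ?_, fun i x => ?_, fun i x => ?_, fun i x => ?_⟩
  · rw [← map_one (RingQuot.mkAlgHom ℂ (Rel n q)), hΦ, hΦ₀]
    simp
  all_goals obtain ⟨x, rfl⟩ := hsurj x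
  · rw [← mkAlgHom_ι, ← map_mul, hΦ, hΦ₀, map_mul, hρf]
    exact lapply_nil_vermaF _ _
  · rw [← mkAlgHom_ι, ← map_mul, hΦ, hΦ₀, map_mul, hρe]
    simp [vermaE_nil]
  · rw [← mkAlgHom_ι, ← map_mul, hΦ, hΦ, hΦ₀, hΦ₀, map_mul, hρK]
    exact congrArg (fun T => T (ρ x (Finsupp.single [] 1))) (lapply_nil_vermaK (q := q) c i)
  · rw [← mkAlgHom_ι, ← map_mul, hΦ, hΦ, hΦ₀, hΦ₀, map_mul, hρK']
    exact congrArg (fun T => T (ρ x (Finsupp.single [] 1))) (lapply_nil_vermaK (q := q⁻¹) c' i)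

end Functional

/-! ### Directness of the decomposition and evaluation of the projection. -/

section Projection

variable {n : ℕ} {q : ℂ} {R : Type*} [CommRing R] [Algebra ℂ R] {Φ : Uq n q →ₗ[ℂ] R}
  {c c' : Fin n → R}

namespace IsHighestWeightFunctional

theorem map_offCartan (h : IsHighestWeightFunctional Φ c c') {x : Uq n q}
    (hx : x ∈ offCartan n q) : Φ x = 0 := by
  have hle : offCartan n q ≤ LinearMap.ker Φ := by
    refine sup_le (Submodule.span_le.2 ?_) (Submodule.span_le.2 ?_)
    · rintro _ ⟨i, x, rfl⟩
      exact h.f_mul i x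
    · rintro _ ⟨i, x, rfl⟩
      exact h.mul_e i x
  exact hle hx

theorem map_mul_of_mem_cartan (h : IsHighestWeightFunctional Φ c c') {y : Uq n q}
    (hy : y ∈ cartan n q) : ∀ x, Φ (y * x) = Φ y * Φ x := by
  have h1 (i) : Φ (gen q (Gen.K i)) = c i := by simpa [h.map_one] using h.K_mul i 1
  have h2 (i) : Φ (gen q (Gen.Kinv i)) = c' i := by simpa [h.map_one] using h.Kinv_mul i 1
  induction hy using Algebra.adjoin_induction with
  | mem s hs =>
    rcases hs with ⟨i, rfl⟩ | ⟨i, rfl⟩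
    · intro x; rw [h.K_mul, h1]
    · intro x; rw [h.Kinv_mul, h2]
  | algebraMap r =>
    intro x
    rw [Algebra.algebraMap_eq_smul_one, smul_mul_assoc, one_mul, map_smul, map_smul, h.map_one,
      smul_mul_assoc, one_mul]
  | add a b _ _ ha hb => intro x; rw [add_mul, map_add, map_add, ha, hb, add_mul]
  | mul a b _ _ ha hb => intro x; rw [mul_assoc, ha, ha, hb, mul_assoc]

/-- The algebra homomorphism on the Cartan subalgebra defined by a highest weight functional. -/
def cartanHom (h : IsHighestWeightFunctional Φ c c') : cartan n q →ₐ[ℂ] R :=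
  AlgHom.ofLinearMap (Φ ∘ₗ (Subalgebra.toSubmodule (cartan n q)).subtype) h.map_one
    fun x y => h.map_mul_of_mem_cartan x.2 y

theorem cartanHom_apply (h : IsHighestWeightFunctional Φ c c') (x : cartan n q) :
    h.cartanHom x = Φ x := rfl

theorem cartanHom_cartanK (h : IsHighestWeightFunctional Φ c c') (i : Fin n) :
    h.cartanHom (cartanK q i) = c i := by
  have h1 : Φ (gen q (Gen.K i)) = c i := by simpa [h.map_one] using h.K_mul i 1
  exact h1

end IsHighestWeightFunctional

/-- The element `q^{-h_α}` of the Cartan subalgebra. -/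
def cartanKinv (q : ℂ) (i : Fin n) : cartan n q := ⟨gen q (Gen.Kinv i), gen_Kinv_mem_cartan i⟩

theorem cartanK_mul_cartanKinv (i : Fin n) : cartanK q i * cartanKinv q i = 1 :=
  Subtype.ext ((chevalleyFamily_gen n q).K_mul i)

theorem cartanHom_ext {B : Type*} [Semiring B] [Algebra ℂ B] {φ ψ : cartan n q →ₐ[ℂ] B}
    (h : ∀ i, φ (cartanK q i) = ψ (cartanK q i)) : φ = ψ := by
  have h' (i) : φ (cartanKinv q i) = ψ (cartanKinv q i) := by
    have h1 : cartanKinv q i * cartanK q i = 1 :=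
      Subtype.ext ((chevalleyFamily_gen n q).mul_K i)
    refine left_inv_eq_right_inv (a := φ (cartanK q i)) ?_ ?_
    · rw [← map_mul, h1, map_one]
    · rw [h, ← map_mul, cartanK_mul_cartanKinv, map_one]
  refine AlgHom.adjoin_ext ?_
  rintro x (⟨i, rfl⟩ | ⟨i, rfl⟩)
  · exact h i
  · exact h' i

theorem cartan_commute (a : Uq n q) (ha : a ∈ Set.range (fun i : Fin n => gen q (Gen.K i)) ∪
      Set.range (fun i => gen q (Gen.Kinv i))) (b : Uq n q)
    (hb : b ∈ Set.range (fun i : Fin n => gen q (Gen.K i)) ∪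
      Set.range (fun i => gen q (Gen.Kinv i))) : a * b = b * a := by
  have hf := chevalleyFamily_gen n q
  have h1 (i j : Fin n) : gen q (Gen.K i) * gen q (Gen.Kinv j) =
      gen q (Gen.Kinv j) * gen q (Gen.K i) := by
    simpa using (ChevalleyFamily.inv_comm one_ne_zero (hf.K_mul j) (hf.mul_K j)
      (x := gen q (Gen.K i)) (by simpa using hf.K_comm j i)).symm
  rcases ha with ⟨i, rfl⟩ | ⟨i, rfl⟩ <;> rcases hb with ⟨j, rfl⟩ | ⟨j, rfl⟩
  · exact hf.K_comm i j
  · exact h1 i j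
  · exact (h1 j i).symm
  · exact hf.K'_comm i j

theorem cartanSplits (n : ℕ) {q : ℂ} (hq : q ≠ 0) : CartanSplits n q := by
  refine ⟨?_, codisjoint_iff.2 (cartan_sup_offCartan hq)⟩
  have : IsMulCommutative (cartan n q) := Algebra.isMulCommutative_adjoin ℂ cartan_commute
  let : CommRing (cartan n q) := { (cartan n q).toRing with mul_comm := mul_comm' }
  -- The coefficient ring is the Cartan subalgebra itself with its tautological weight; `Φ` is then
  -- the identity there while killing `offCartan`.
  obtain ⟨Φ, hΦ⟩ := exists_isHighestWeightFunctional (R := cartan n q) hq (cartanK q)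
    (cartanKinv q) cartanK_mul_cartanKinv
  rw [Submodule.disjoint_def]
  intro x hx hx'
  have h1 : hΦ.cartanHom = AlgHom.id ℂ (cartan n q) :=
    cartanHom_ext fun i => hΦ.cartanHom_cartanK i
  have h2 : hΦ.cartanHom ⟨x, hx⟩ = ⟨x, hx⟩ := by rw [h1]; rfl
  rw [hΦ.cartanHom_apply, hΦ.map_offCartan hx'] at h2
  exact (congrArg Subtype.val h2).symm

theorem eval_harishChandra (hs : CartanSplits n q) (hΦ : IsHighestWeightFunctional Φ c c')
    {ev : cartan n q →ₐ[ℂ] R} (hev : ∀ i, ev (cartanK q i) = c i) (x : Uq n q) :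
    ev (harishChandra hs x) = Φ x := by
  have h1 : ev = hΦ.cartanHom :=
    cartanHom_ext fun i => by rw [hev, hΦ.cartanHom_cartanK]
  have h2 : x - harishChandra hs x ∈ offCartan n q := by
    rw [← Submodule.projectionOnto_apply_eq_zero_iff hs, map_sub, sub_eq_zero]
    exact (Submodule.projectionOnto_apply_left hs _).symm
  have h3 := hΦ.map_offCartan h2
  rw [map_sub, sub_eq_zero] at h3
  rw [h1, hΦ.cartanHom_apply, h3]

theorem existsUnique_isEvalAt (hq : q ≠ 0) (hbar : ℂ) (lam : Fin n → ℂ) :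
    ∃! ev : cartan n q →ₐ[ℂ] ℂ, IsEvalAt hbar lam ev := by
  obtain ⟨Φ, hΦ⟩ := exists_isHighestWeightFunctional (n := n) hq
    (fun i => Complex.exp (hbar * weightForm lam i))
    (fun i => (Complex.exp (hbar * weightForm lam i))⁻¹)
    fun i => mul_inv_cancel₀ (Complex.exp_ne_zero _)
  exact ⟨hΦ.cartanHom, hΦ.cartanHom_cartanK, fun ev hev => cartanHom_ext fun i => by
    rw [hev i, hΦ.cartanHom_cartanK]⟩

end Projection

/-! ### Algebra of weighted shift operators. -/

section WeightedShift

/-- The operator `(T ψ)(m) = a(m) ψ(m + d)` on functions of infinitely many integers. -/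
def wshift (a : (ℕ → ℤ) → ℂ) (d : ℕ → ℤ) : Module.End ℂ ((ℕ → ℤ) → ℂ) where
  toFun ψ m := a m * ψ (m + d)
  map_add' ψ χ := by funext m; simp [mul_add]
  map_smul' c ψ := by funext m; simp [mul_left_comm]

theorem wshift_apply (a : (ℕ → ℤ) → ℂ) (d : ℕ → ℤ) (ψ : (ℕ → ℤ) → ℂ) (m : ℕ → ℤ) :
    wshift a d ψ m = a m * ψ (m + d) := rfl

theorem wshift_congr {a b : (ℕ → ℤ) → ℂ} {d d' : ℕ → ℤ} (h : ∀ m, a m = b m) (hd : d = d') :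
    wshift a d = wshift b d' := by
  rw [funext h, hd]

theorem wshift_mul (a b : (ℕ → ℤ) → ℂ) (d d' : ℕ → ℤ) :
    wshift a d * wshift b d' = wshift (fun m => a m * b (m + d)) (d + d') := by
  refine LinearMap.ext fun ψ => funext fun m => ?_
  simp [wshift_apply, mul_assoc, add_assoc]

theorem smul_wshift (c : ℂ) (a : (ℕ → ℤ) → ℂ) (d : ℕ → ℤ) :
    c • wshift a d = wshift (fun m => c * a m) d := by
  refine LinearMap.ext fun ψ => funext fun m => ?_
  simp [wshift_apply, mul_assoc]

theorem wshift_sub (a b : (ℕ → ℤ) → ℂ) (d : ℕ → ℤ) :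
    wshift a d - wshift b d = wshift (fun m => a m - b m) d := by
  refine LinearMap.ext fun ψ => funext fun m => ?_
  simp [wshift_apply, sub_mul]

theorem wshift_zero (d : ℕ → ℤ) : wshift (fun _ => 0) d = 0 := by
  refine LinearMap.ext fun ψ => funext fun m => ?_
  simp [wshift_apply]

theorem one_eq_wshift : (1 : Module.End ℂ ((ℕ → ℤ) → ℂ)) = wshift (fun _ => 1) 0 := by
  refine LinearMap.ext fun ψ => funext fun m => ?_
  simp [wshift_apply]

theorem qcomm_wshift (c : ℂ) (a b : (ℕ → ℤ) → ℂ) (d d' : ℕ → ℤ) :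
    qcomm c (wshift a d) (wshift b d') =
      wshift (fun m => a m * b (m + d) - c * (b m * a (m + d'))) (d + d') := by
  rw [qcomm, wshift_mul, wshift_mul, smul_wshift, add_comm d' d, wshift_sub]

/-- A Serre element in shifts is again a single shift, so its vanishing is one scalar identity in
the coefficients. -/
theorem serre_wshift {q : ℂ} (hq : q ≠ 0) (a b : (ℕ → ℤ) → ℂ) (d d' : ℕ → ℤ) :
    qcomm q⁻¹ (wshift a d) (qcomm q (wshift a d) (wshift b d')) =
      wshift (fun m => a m * a (m + d) * b (m + d + d) -
        (q + q⁻¹) * (a m * b (m + d) * a (m + d + d')) + b m * a (m + d') * a (m + d + d'))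
        (d + (d + d')) := by
  rw [qcomm_wshift, qcomm_wshift]
  refine wshift_congr (fun m => ?_) rfl
  rw [← add_assoc]
  field_simp
  ring

end WeightedShift

/-! ### The oscillator representation. -/

section Oscillator

/-- The simple roots, with coordinates indexed by all natural numbers. -/
def natRoot (i : ℕ) : ℕ → ℤ := fun l => if l = i then 1 else if l + 1 = i then -1 else 0

/-- `[z]_q` for an integer `z`. -/
def qInt (q : ℂ) (z : ℤ) : ℂ := (q ^ z - (q ^ z)⁻¹) / (q - q⁻¹)

/-- The pairing of a vector with a simple root. -/
def rootPairing (i : ℕ) (m : ℕ → ℤ) : ℤ := m i - if i = 0 then 0 else m (i - 1)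

theorem rootPairing_add (i : ℕ) (m m' : ℕ → ℤ) :
    rootPairing i (m + m') = rootPairing i m + rootPairing i m' := by
  simp only [rootPairing, Pi.add_apply]
  split_ifs <;> ring

theorem rootPairing_neg (i : ℕ) (m : ℕ → ℤ) : rootPairing i (-m) = -rootPairing i m := by
  simp only [rootPairing, Pi.neg_apply]
  split_ifs <;> ring

theorem rootPairing_natRoot {n : ℕ} (i j : Fin n) : rootPairing i (natRoot j) = rootForm i j := by
  simp only [rootForm_eq, rootPairing, natRoot, Fin.ext_iff]
  split_ifs <;> omega

variable {q κ C : ℂ}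

/-- The coefficients of `f_α` in the oscillator representation. -/
def oscFCoeff (q : ℂ) (i : ℕ) (m : ℕ → ℤ) : ℂ := if i = 0 then 1 else qInt q (m (i - 1) + 1)

/-- The coefficients of `e_α` in the oscillator representation. -/
def oscECoeff (q C : ℂ) (i : ℕ) (m : ℕ → ℤ) : ℂ := (if i = 0 then C else 1) * qInt q (m i + 1)

/-- The highest weight of the oscillator representation. -/
def oscWeight (κ : ℂ) (i : ℕ) : ℂ := if i = 0 then κ else 1

/-- `f_α` in the oscillator representation. -/
def oscF (q : ℂ) (i : ℕ) : Module.End ℂ ((ℕ → ℤ) → ℂ) := wshift (oscFCoeff q i) (-natRoot i)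

/-- `e_α` in the oscillator representation. -/
def oscE (q C : ℂ) (i : ℕ) : Module.End ℂ ((ℕ → ℤ) → ℂ) := wshift (oscECoeff q C i) (natRoot i)

/-- `q^{h_α}` in the oscillator representation. -/
def oscK (q κ : ℂ) (i : ℕ) : Module.End ℂ ((ℕ → ℤ) → ℂ) :=
  wshift (fun m => oscWeight κ i * q ^ (-rootPairing i m)) 0

theorem oscWeight_mul_inv (hκ : κ ≠ 0) (i : ℕ) : oscWeight κ i * oscWeight κ⁻¹ i = 1 := by
  unfold oscWeight; split_ifs <;> simp [hκ]

theorem oscK_mul_inv (hq : q ≠ 0) (hκ : κ ≠ 0) (i : ℕ) : oscK q κ i * oscK q⁻¹ κ⁻¹ i = 1 := by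
  rw [oscK, oscK, wshift_mul, one_eq_wshift]
  refine wshift_congr (fun m => ?_) (add_zero _)
  rw [add_zero, mul_mul_mul_comm, oscWeight_mul_inv hκ, inv_zpow,
    mul_inv_cancel₀ (zpow_ne_zero _ hq), one_mul]

theorem oscK_comm (i j : ℕ) : oscK q κ i * oscK q κ j = oscK q κ j * oscK q κ i := by
  rw [oscK, oscK, wshift_mul, wshift_mul]
  exact wshift_congr (fun m => by rw [add_zero, mul_comm]) rfl

theorem oscK_mul_wshift (hq : q ≠ 0) (i : ℕ) (a : (ℕ → ℤ) → ℂ) (d : ℕ → ℤ) :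
    oscK q κ i * wshift a d = q ^ rootPairing i d • (wshift a d * oscK q κ i) := by
  rw [oscK, wshift_mul, wshift_mul, smul_wshift]
  refine wshift_congr (fun m => ?_) (by rw [add_zero, zero_add])
  rw [rootPairing_add, neg_add, zpow_add₀ hq, zpow_neg q (rootPairing i d), add_zero]
  have := zpow_ne_zero (rootPairing i d) hq
  field_simp

theorem natRoot_self (i : ℕ) : natRoot i i = 1 := by simp [natRoot]

theorem natRoot_succ_self (i : ℕ) : natRoot (i + 1) i = -1 := by simp [natRoot]

theorem natRoot_of_ne {i j : ℕ} (h : j ≠ i) (h' : j + 1 ≠ i) : natRoot i j = 0 := by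
  simp [natRoot, h, h']

theorem sq_sub_one_ne_zero (hq : q ≠ 0) (hq2 : q - q⁻¹ ≠ 0) : q ^ 2 - 1 ≠ 0 := fun h => hq2 (by
  rw [show q - q⁻¹ = (q ^ 2 - 1) / q by field_simp, h, zero_div])

theorem qInt_zero : qInt q 0 = 0 := by simp [qInt]

/-- This is the relation `[e_α, f_α]` for a long simple root, read on coefficients. -/
theorem qInt_mul_sub_mul (hq : q ≠ 0) (hq2 : q - q⁻¹ ≠ 0) (a b : ℤ) :
    qInt q (b + 1) * qInt q a - qInt q (a + 1) * qInt q b =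
      (q - q⁻¹)⁻¹ * (q ^ (a - b) - (q ^ (a - b))⁻¹) := by
  have ha := zpow_ne_zero a hq
  have hb := zpow_ne_zero b hq
  simp only [qInt, zpow_add₀ hq, zpow_sub₀ hq, zpow_one]
  generalize q ^ a = x at *
  generalize q ^ b = y at *
  have h := sq_sub_one_ne_zero hq hq2
  field_simp
  ring

/-- All Serre relations of the oscillator representation reduce to this three-term recursion. -/
theorem qInt_add_one_add_sub_one (hq : q ≠ 0) (a : ℤ) :
    qInt q (a + 1) + qInt q (a - 1) = (q + q⁻¹) * qInt q a := by
  have ha := zpow_ne_zero a hq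
  simp only [qInt, zpow_add₀ hq, zpow_sub₀ hq, zpow_one]
  generalize q ^ a = x at *
  rw [← add_div, ← mul_div_assoc]
  congr 1
  field_simp
  ring

theorem qInt_sub_mul (hq : q ≠ 0) (hq2 : q - q⁻¹ ≠ 0) (a : ℤ) :
    qInt q a - q * qInt q (a + 1) = -q * q ^ a := by
  have ha := zpow_ne_zero a hq
  simp only [qInt, zpow_add₀ hq, zpow_one]
  generalize q ^ a = x at *
  have h := sq_sub_one_ne_zero hq hq2
  field_simp
  ring

theorem qInt_sub_inv_mul (hq : q ≠ 0) (hq2 : q - q⁻¹ ≠ 0) (a : ℤ) :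
    qInt q a - q⁻¹ * qInt q (a + 1) = -q⁻¹ * (q ^ a)⁻¹ := by
  have ha := zpow_ne_zero a hq
  simp only [qInt, zpow_add₀ hq, zpow_one]
  generalize q ^ a = x at *
  have h := sq_sub_one_ne_zero hq hq2
  field_simp
  ring

/-- The short-root relation `[e_α, f_α]` on coefficients. The left side is a multiple of `q^a + q⁻¹
q^{-a}`; `C` matches the first term, and `κ² = -q⁻¹` then forces the second to agree. -/
theorem qInt_add_one_sub (hq : q ≠ 0) (hq2 : q - q⁻¹ ≠ 0) (hκ : κ ^ 2 = -q⁻¹)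
    (hC : C * (κ * (q - 1)) = -1) (a : ℤ) :
    C * qInt q (a + 1) - C * qInt q a =
      (q - q⁻¹)⁻¹ * (κ * (q ^ a)⁻¹ - κ⁻¹ * q ^ a) := by
  have ha := zpow_ne_zero a hq
  have hκ0 : κ ≠ 0 := by rintro rfl; simp [hq] at hκ
  have hq1 : q - 1 ≠ 0 := by intro h; simp [h] at hC
  have hC' : C = -(κ * (q - 1))⁻¹ := by
    field_simp; linear_combination hC
  have hκ' : κ * (q ^ a)⁻¹ = -κ⁻¹ * q⁻¹ * (q ^ a)⁻¹ := by
    congr 1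
    field_simp
    rw [hκ]
    field_simp
  rw [hκ']
  simp only [qInt, zpow_add₀ hq, zpow_one, hC']
  generalize q ^ a = x at *
  have h := sq_sub_one_ne_zero hq hq2
  field_simp
  ring

theorem oscE_oscF_self (hq : q ≠ 0) (hq2 : q - q⁻¹ ≠ 0) (hκ : κ ^ 2 = -q⁻¹)
    (hC : C * (κ * (q - 1)) = -1) (i : ℕ) :
    qcomm 1 (oscE q C i) (oscF q i) = (q - q⁻¹)⁻¹ • (oscK q κ i - oscK q⁻¹ κ⁻¹ i) := by
  rw [oscE, oscF, qcomm_wshift, oscK, oscK, wshift_sub, smul_wshift]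
  refine wshift_congr (fun m => ?_) (add_neg_cancel _)
  cases i with
  | zero =>
    have h := qInt_add_one_sub hq hq2 hκ hC (m 0)
    simp only [oscECoeff, oscFCoeff, oscWeight, rootPairing, Pi.add_apply, Pi.neg_apply,
      natRoot_self, if_true, sub_zero, inv_zpow, zpow_neg, inv_inv, neg_add_cancel_right]
    linear_combination h
  | succ i =>
    have h := qInt_mul_sub_mul hq hq2 (m i) (m (i + 1))
    simp only [oscECoeff, oscFCoeff, oscWeight, rootPairing, Pi.add_apply, Pi.neg_apply,
      natRoot_self, natRoot_succ_self, Nat.succ_ne_zero, if_false, inv_zpow,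
      neg_add_cancel_right, Nat.add_sub_cancel, one_mul, neg_sub]
    linear_combination h

theorem oscE_oscF_of_ne {i j : ℕ} (hij : i ≠ j) : qcomm 1 (oscE q C i) (oscF q j) = 0 := by
  rw [oscE, oscF, qcomm_wshift, ← wshift_zero]
  refine wshift_congr (fun m => ?_) rfl
  simp only [oscECoeff, oscFCoeff, Pi.add_apply, Pi.neg_apply]
  rcases Nat.eq_zero_or_pos j with rfl | hj
  · simp [natRoot_of_ne hij (by omega)]
  · obtain ⟨j, rfl⟩ : ∃ k, j = k + 1 := ⟨j - 1, by omega⟩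
    simp only [Nat.add_sub_cancel, Nat.succ_ne_zero, if_false]
    rcases eq_or_ne i j with rfl | h
    · simp only [natRoot_self, natRoot_succ_self, neg_neg]; ring
    · simp only [natRoot_of_ne (i := i) (j := j) h.symm (Ne.symm hij),
        natRoot_of_ne (i := j + 1) (j := i) hij (by omega), add_zero, neg_zero]
      ring

theorem oscE_comm {i j : ℕ} (h0 : i ≠ j) (h1 : i + 1 ≠ j) (h2 : j + 1 ≠ i) :
    qcomm 1 (oscE q C i) (oscE q C j) = 0 := by
  rw [oscE, oscE, qcomm_wshift, ← wshift_zero]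
  refine wshift_congr (fun m => ?_) rfl
  simp only [oscECoeff, Pi.add_apply, natRoot_of_ne h0 h1, natRoot_of_ne h0.symm h2, add_zero]
  ring

theorem oscF_comm {i j : ℕ} (h0 : i ≠ j) (h1 : i + 1 ≠ j) (h2 : j + 1 ≠ i) :
    qcomm 1 (oscF q i) (oscF q j) = 0 := by
  rw [oscF, oscF, qcomm_wshift, ← wshift_zero]
  refine wshift_congr (fun m => ?_) rfl
  have h (i j : ℕ) (h0 : i ≠ j) (h1 : i + 1 ≠ j) (h2 : j + 1 ≠ i) :
      oscFCoeff q i (m + -natRoot j) = oscFCoeff q i m := by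
    simp only [oscFCoeff, Pi.add_apply, Pi.neg_apply]
    split_ifs
    · rfl
    · rw [natRoot_of_ne (by omega) (by omega), neg_zero, add_zero]
  rw [h i j h0 h1 h2, h j i h0.symm h2 h1]
  ring

theorem natRoot_succ_eq_zero (i : ℕ) : natRoot i (i + 1) = 0 :=
  natRoot_of_ne (by omega) (by omega)

theorem oscE_serre_succ (hq : q ≠ 0) (i : ℕ) :
    qcomm q⁻¹ (oscE q C i) (qcomm q (oscE q C i) (oscE q C (i + 1))) = 0 := by
  rw [oscE, oscE, serre_wshift hq, ← wshift_zero]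
  refine wshift_congr (fun m => ?_) rfl
  have h := qInt_add_one_add_sub_one hq (m i + 1)
  simp only [oscECoeff, Pi.add_apply, natRoot_self, natRoot_succ_self, natRoot_succ_eq_zero,
    add_zero, Nat.succ_ne_zero, if_false, neg_add_cancel_right, add_sub_cancel_right,
    add_neg_cancel_right] at h ⊢
  generalize (if i = 0 then C else 1) = c
  linear_combination c ^ 2 * qInt q (m i + 1) * qInt q (m (i + 1) + 1) * h

theorem oscE_serre_pred (hq : q ≠ 0) (i : ℕ) :
    qcomm q⁻¹ (oscE q C (i + 1)) (qcomm q (oscE q C (i + 1)) (oscE q C i)) = 0 := by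
  rw [oscE, oscE, serre_wshift hq, ← wshift_zero]
  refine wshift_congr (fun m => ?_) rfl
  have h := qInt_add_one_add_sub_one hq (m i)
  simp only [oscECoeff, Pi.add_apply, natRoot_self, natRoot_succ_self, natRoot_succ_eq_zero,
    add_zero, Nat.succ_ne_zero, if_false, neg_add_cancel_right, sub_eq_add_neg] at h ⊢
  generalize (if i = 0 then C else 1) = c
  linear_combination c * qInt q (m (i + 1) + 1) * qInt q (m (i + 1) + 1 + 1) * h

theorem oscFCoeff_add_of_eq_zero {i : ℕ} {d : ℕ → ℤ} (hd : i ≠ 0 → d (i - 1) = 0)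
    (m : ℕ → ℤ) : oscFCoeff q i (m + d) = oscFCoeff q i m := by
  unfold oscFCoeff
  split_ifs with h
  · rfl
  · rw [Pi.add_apply, hd h, add_zero]

theorem oscF_serre_succ (hq : q ≠ 0) (i : ℕ) :
    qcomm q⁻¹ (oscF q i) (qcomm q (oscF q i) (oscF q (i + 1))) = 0 := by
  rw [oscF, oscF, serre_wshift hq, ← wshift_zero]
  refine wshift_congr (fun m => ?_) rfl
  have h := qInt_add_one_add_sub_one hq (m i)
  have h0 (m) : oscFCoeff q i (m + -natRoot (i + 1)) = oscFCoeff q i m :=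
    oscFCoeff_add_of_eq_zero (fun hi => by
      rw [Pi.neg_apply, natRoot_of_ne (by omega) (by omega), neg_zero]) m
  have h1 (m) : oscFCoeff q (i + 1) m = qInt q (m i + 1) := by simp [oscFCoeff]
  rw [h0, h0]
  simp only [h1, Pi.add_apply, Pi.neg_apply, natRoot_self, sub_eq_add_neg,
    neg_add_cancel_right] at h ⊢
  linear_combination oscFCoeff q i m * oscFCoeff q i (m + -natRoot i) * h

theorem oscF_serre_pred (hq : q ≠ 0) (i : ℕ) :
    qcomm q⁻¹ (oscF q (i + 1)) (qcomm q (oscF q (i + 1)) (oscF q i)) = 0 := by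
  rw [oscF, oscF, serre_wshift hq, ← wshift_zero]
  refine wshift_congr (fun m => ?_) rfl
  have h := qInt_add_one_add_sub_one hq (m i + 1)
  have h0 (m) : oscFCoeff q i (m + -natRoot (i + 1)) = oscFCoeff q i m :=
    oscFCoeff_add_of_eq_zero (fun hi => by
      rw [Pi.neg_apply, natRoot_of_ne (by omega) (by omega), neg_zero]) m
  have h1 (m) : oscFCoeff q (i + 1) m = qInt q (m i + 1) := by simp [oscFCoeff]
  rw [h0, h0]
  simp only [h1, Pi.add_apply, Pi.neg_apply, natRoot_self, natRoot_succ_self, neg_neg,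
    neg_add_cancel_right, add_sub_cancel_right, add_neg_cancel_right] at h ⊢
  linear_combination oscFCoeff q i m * qInt q (m i + 1) * h

/-- The oscillator representation of `U_q(so(2n+1))`. -/
theorem exists_oscillator (n : ℕ) (hq : q ≠ 0) (hq2 : q - q⁻¹ ≠ 0) (hκ : κ ^ 2 = -q⁻¹)
    (hC : C * (κ * (q - 1)) = -1) :
    ∃ ρ : Uq n q →ₐ[ℂ] Module.End ℂ ((ℕ → ℤ) → ℂ),
      (∀ i, ρ (gen q (Gen.e i)) = oscE q C i) ∧ (∀ i, ρ (gen q (Gen.f i)) = oscF q i) ∧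
      (∀ i, ρ (gen q (Gen.K i)) = oscK q κ i) ∧
      ∀ i, ρ (gen q (Gen.Kinv i)) = oscK q⁻¹ κ⁻¹ i := by
  have hκ0 : κ ≠ 0 := by rintro rfl; simp [hq] at hκ
  have hinv (i : ℕ) : oscK q κ i * oscK q⁻¹ κ⁻¹ i = 1 := oscK_mul_inv hq hκ0 i
  have hadj {i j : Fin n} (h : 2 * rootForm i j = -rootForm i i) :
      (i : ℕ) + 1 = j ∨ (j : ℕ) + 1 = i := by
    obtain ⟨hij, -, h⟩ := rootForm_of_serre h
    rw [rootForm_eq, if_neg hij] at h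
    by_contra h'
    simp [h'] at h
  have hnadj {i j : Fin n} (h : rootForm i j = 0) :
      (i : ℕ) ≠ j ∧ (i : ℕ) + 1 ≠ j ∧ (j : ℕ) + 1 ≠ i := by
    have hij := ne_of_rootForm_eq_zero h
    rw [rootForm_eq, if_neg hij] at h
    refine ⟨fun h' => hij (Fin.ext h'), fun h' => ?_, fun h' => ?_⟩ <;> simp [h'] at h
  let ρ₀ : FreeAlgebra ℂ (Gen n) →ₐ[ℂ] Module.End ℂ ((ℕ → ℤ) → ℂ) :=
    FreeAlgebra.lift ℂ (genImage (fun i : Fin n => oscE q C i) (fun i => oscF q i)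
      (fun i => oscK q κ i) (fun i => oscK q⁻¹ κ⁻¹ i))
  have hρe (i) : ρ₀ (FreeAlgebra.ι ℂ (Gen.e i)) = oscE q C i := FreeAlgebra.lift_ι_apply _ _
  have hρf (i) : ρ₀ (FreeAlgebra.ι ℂ (Gen.f i)) = oscF q i := FreeAlgebra.lift_ι_apply _ _
  have hρK (i) : ρ₀ (FreeAlgebra.ι ℂ (Gen.K i)) = oscK q κ i := FreeAlgebra.lift_ι_apply _ _
  have hρK' (i) : ρ₀ (FreeAlgebra.ι ℂ (Gen.Kinv i)) = oscK q⁻¹ κ⁻¹ i :=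
    FreeAlgebra.lift_ι_apply _ _
  have hρq (a : ℂ) (x y) : ρ₀ (qcomm a x y) = qcomm a (ρ₀ x) (ρ₀ y) := by simp [qcomm]
  have hrel : ∀ ⦃x y⦄, Rel n q x y → ρ₀ x = ρ₀ y := by
    intro x y hxy
    cases hxy with
    | K_mul_Kinv i => rw [map_mul, map_one, hρK, hρK', hinv]
    | Kinv_mul_K i =>
      rw [map_mul, map_one, hρK, hρK']
      simpa using oscK_mul_inv (inv_ne_zero hq) (inv_ne_zero hκ0) (i : ℕ)
    | K_comm i j => rw [map_mul, map_mul, hρK, hρK, oscK_comm]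
    | K_e i j =>
      rw [map_mul, map_mul, map_smul, hρK, hρK', hρe, oscE, oscK_mul_wshift hq, smul_mul_assoc,
        mul_assoc, hinv, mul_one, rootPairing_natRoot]
    | K_f i j =>
      rw [map_mul, map_mul, map_smul, hρK, hρK', hρf, oscF, oscK_mul_wshift hq, smul_mul_assoc,
        mul_assoc, hinv, mul_one, rootPairing_neg, rootPairing_natRoot]
    | e_f i j =>
      rw [hρq, hρe, hρf]
      rcases eq_or_ne i j with rfl | hij
      · rw [oscE_oscF_self hq hq2 hκ hC, if_pos rfl, map_smul, map_sub, hρK, hρK']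
      · rw [oscE_oscF_of_ne (fun h => hij (Fin.ext h)), if_neg hij, map_zero]
    | serre_e i j h =>
      rw [hρq, hρq, hρe, hρe, map_zero]
      rcases hadj h with h | h <;> rw [← h]
      · exact oscE_serre_succ hq _
      · exact oscE_serre_pred hq _
    | serre_f i j h =>
      rw [hρq, hρq, hρf, hρf, map_zero]
      rcases hadj h with h | h <;> rw [← h]
      · exact oscF_serre_succ hq _
      · exact oscF_serre_pred hq _
    | serre_short_e i j hi hj =>
      -- In this representation the inner quadratic Serre element already vanishes for the short
      -- root.
      rw [hρq, hρq, hρq, hρe, hρe, map_zero, hi, hj, oscE_serre_succ hq 0]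
      simp [qcomm]
    | serre_short_f i j hi hj =>
      rw [hρq, hρq, hρq, hρf, hρf, map_zero, hi, hj, oscF_serre_succ hq 0]
      simp [qcomm]
    | e_comm i j h =>
      obtain ⟨h0, h1, h2⟩ := hnadj h
      rw [hρq, hρe, hρe, map_zero, oscE_comm h0 h1 h2]
    | f_comm i j h =>
      obtain ⟨h0, h1, h2⟩ := hnadj h
      rw [hρq, hρf, hρf, map_zero, oscF_comm h0 h1 h2]
  refine ⟨RingQuot.liftAlgHom ℂ ⟨ρ₀, hrel⟩, fun i => ?_, fun i => ?_, fun i => ?_, fun i => ?_⟩ <;>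
    rw [← mkAlgHom_ι, RingQuot.liftAlgHom_mkAlgHom_apply]
  · exact hρe i
  · exact hρf i
  · exact hρK i
  · exact hρK' i

end Oscillator

/-! ### Action of the root vectors and vacuum coefficients of monomials. -/

section RootVectors

variable {n : ℕ} {q κ C : ℂ} {ρ : Uq n q →ₐ[ℂ] Module.End ℂ ((ℕ → ℤ) → ℂ)}

theorem natRoot_zero : natRoot 0 = Pi.single 0 1 := by
  funext l
  simp [natRoot, Pi.single_apply]

theorem natRoot_succ (i : ℕ) : natRoot (i + 1) = Pi.single (i + 1) 1 - Pi.single i 1 := by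
  funext l
  simp only [natRoot, Pi.sub_apply, Pi.single_apply]
  split_ifs <;> omega

theorem map_qcomm_Uq (a : ℂ) (x y : Uq n q) : ρ (qcomm a x y) = qcomm a (ρ x) (ρ y) := by
  simp [qcomm]

/-- The action of `f_{ε_i}` in the oscillator representation. -/
def oscFEps (q : ℂ) (i : ℕ) : Module.End ℂ ((ℕ → ℤ) → ℂ) :=
  wshift (fun m => ∏ j ∈ Finset.range i, (-q⁻¹ * (q ^ m j)⁻¹)) (-Pi.single i 1)

/-- The action of `e_{ε_i}` in the oscillator representation. -/
def oscEEps (q C : ℂ) (i : ℕ) : Module.End ℂ ((ℕ → ℤ) → ℂ) :=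
  wshift (fun m => C * (∏ j ∈ Finset.range i, (-q * q ^ m j)) * qInt q (m i + 1)) (Pi.single i 1)

/-- By `qInt_sub_inv_mul` each `q⁻¹`-commutator collapses a difference of `q`-numbers to one power
of `q`, so the coefficient stays a product. -/
theorem map_fEps (hq : q ≠ 0) (hq2 : q - q⁻¹ ≠ 0)
    (hρ : ∀ i, ρ (gen q (Gen.f i)) = oscF q i) : ∀ (i : ℕ) (h : i < n),
    ρ (fEps q i h) = oscFEps q i
  | 0, h => by
    rw [fEps, hρ, oscF, oscFEps]
    exact wshift_congr (fun m => by simp [oscFCoeff]) (by rw [natRoot_zero])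
  | i + 1, h => by
    rw [fEps, map_qcomm_Uq, map_fEps hq hq2 hρ i, hρ, oscF, oscFEps, oscFEps, qcomm_wshift]
    refine wshift_congr (fun m => ?_) (by rw [natRoot_succ]; abel)
    have h1 : ∏ j ∈ Finset.range i, (-q⁻¹ * (q ^ (m + -natRoot (i + 1)) j)⁻¹) =
        ∏ j ∈ Finset.range i, (-q⁻¹ * (q ^ m j)⁻¹) := by
      refine Finset.prod_congr rfl fun j hj => ?_
      rw [Finset.mem_range] at hj
      rw [Pi.add_apply, Pi.neg_apply, natRoot_of_ne (by omega) (by omega), neg_zero, add_zero]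
    have h2 := qInt_sub_inv_mul hq hq2 (m i)
    rw [h1, Finset.prod_range_succ]
    simp only [oscFCoeff, Nat.succ_ne_zero, if_false, Nat.add_sub_cancel, Pi.add_apply,
      Pi.neg_apply, Pi.single_eq_same, neg_add_cancel_right]
    linear_combination (∏ j ∈ Finset.range i, (-q⁻¹ * (q ^ m j)⁻¹)) * h2

/-- The action of the partial commutators that lead to `e_{ε_i}`. -/
def oscENest (q C : ℂ) (i j : ℕ) : Module.End ℂ ((ℕ → ℤ) → ℂ) :=
  wshift (fun m => (if j = 0 then C else 1) * (∏ l ∈ Finset.Ico j i, (-q * q ^ m l)) *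
    qInt q (m i + 1)) (Pi.single i 1 - if j = 0 then 0 else Pi.single (j - 1) 1)

theorem oscENest_self (i : ℕ) : oscENest q C i i = oscE q C i := by
  refine wshift_congr (fun m => by simp [oscECoeff]) ?_
  cases i with
  | zero => simp [natRoot_zero]
  | succ i => simp [natRoot_succ]

theorem oscENest_zero (i : ℕ) : oscENest q C i 0 = oscEEps q C i :=
  wshift_congr (fun m => by simp) (by simp)

theorem qcomm_oscENest (hq : q ≠ 0) (hq2 : q - q⁻¹ ≠ 0) {i j : ℕ} (hj : j < i) :
    qcomm q (oscENest q C i (j + 1)) (oscE q C j) = oscENest q C i j := by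
  rw [oscENest, oscE, oscENest, qcomm_wshift]
  refine wshift_congr (fun m => ?_) ?_
  · have h1 : ∏ l ∈ Finset.Ico (j + 1) i, (-q * q ^ (m + natRoot j) l) =
        ∏ l ∈ Finset.Ico (j + 1) i, (-q * q ^ m l) := by
      refine Finset.prod_congr rfl fun l hl => ?_
      rw [Finset.mem_Ico] at hl
      rw [Pi.add_apply, natRoot_of_ne (by omega) (by omega), add_zero]
    have h2 := qInt_sub_mul hq hq2 (m j)
    have h3 : (Pi.single i 1 : ℕ → ℤ) j = 0 := Pi.single_eq_of_ne (by omega) _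
    rw [h1, Finset.prod_eq_prod_Ico_succ_bot hj]
    simp only [oscECoeff, Nat.succ_ne_zero, if_false, Nat.add_sub_cancel, Pi.add_apply,
      Pi.sub_apply, h3, Pi.single_eq_same, zero_sub, neg_add_cancel_right, one_mul,
      natRoot_of_ne (i := j) (j := i) (by omega) (by omega), add_zero]
    linear_combination (if j = 0 then C else 1) *
      (∏ l ∈ Finset.Ico (j + 1) i, (-q * q ^ m l)) * qInt q (m i + 1) * h2
  · cases j with
    | zero => simp [natRoot_zero]
    | succ j => simp [natRoot_succ]

theorem map_eNest (hq : q ≠ 0) (hq2 : q - q⁻¹ ≠ 0)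
    (hρ : ∀ i, ρ (gen q (Gen.e i)) = oscE q C i) {i : ℕ} : ∀ (j : ℕ) (h : j ≤ n) (x : Uq n q),
    j ≤ i → ρ x = oscENest q C i j → ρ (eNest q x j h) = oscEEps q C i
  | 0, h, x, _, hx => by rw [eNest, hx, oscENest_zero]
  | j + 1, h, x, hj, hx => by
    rw [eNest]
    refine map_eNest hq hq2 hρ j _ _ (by omega) ?_
    rw [map_qcomm_Uq, hx, hρ, qcomm_oscENest hq hq2 hj]

theorem map_eEps (hq : q ≠ 0) (hq2 : q - q⁻¹ ≠ 0)
    (hρ : ∀ i, ρ (gen q (Gen.e i)) = oscE q C i) (i : Fin n) :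
    ρ (eEps q i) = oscEEps q C i :=
  map_eNest hq hq2 hρ _ _ _ le_rfl (by rw [hρ, oscENest_self])

theorem qNum_eq_qInt (m : ℕ) : qNum q m = qInt q m := by
  simp [qNum, qInt]

open Classical in
/-- The delta function at `m`. -/
def ket (m : ℕ → ℤ) : (ℕ → ℤ) → ℂ := Pi.single m 1

open Classical in
theorem ket_apply (m m' : ℕ → ℤ) : ket m m' = if m' = m then 1 else 0 := Pi.single_apply _ _ _

/-- Vanishing coordinates below `i` reduce the product to `(-q)^i`, and starting from `m i = 0`
makes the last factor run through `[1], …, [k]`. The order of the factors in `eMonomial` ensures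
this vanishing at each stage. -/
theorem oscEEps_pow_apply (i k : ℕ) : ∀ (ψ : (ℕ → ℤ) → ℂ) {m : ℕ → ℤ}, (∀ j ≤ i, m j = 0) →
    (oscEEps q C i ^ k) ψ m =
      C ^ k * (-q) ^ (i * k) * qFactorial q k * ψ (Pi.single i (k : ℤ) + m) := by
  induction k with
  | zero => intro ψ m _; simp [qFactorial]
  | succ k ih =>
    intro ψ m hm
    rw [pow_succ, Module.End.mul_apply, ih _ hm, oscEEps, wshift_apply]
    have h1 : ∏ j ∈ Finset.range i, (-q * q ^ (Pi.single i (k : ℤ) + m : ℕ → ℤ) j) =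
        (-q) ^ i := by
      rw [Finset.prod_congr rfl (g := fun _ => -q), Finset.prod_const, Finset.card_range]
      intro j hj
      rw [Finset.mem_range] at hj
      rw [Pi.add_apply, hm j hj.le, Pi.single_eq_of_ne hj.ne]
      simp
    have h2 : (Pi.single i (k : ℤ) + m : ℕ → ℤ) i + 1 = ((k + 1 : ℕ) : ℤ) := by
      rw [Pi.add_apply, hm i le_rfl, Pi.single_eq_same]; push_cast; ring
    have h3 : (Pi.single i (k : ℤ) + m : ℕ → ℤ) + Pi.single i 1 =
        Pi.single i ((k + 1 : ℕ) : ℤ) + m := by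
      rw [Nat.cast_add, Nat.cast_one, Pi.single_add]; abel
    rw [h1, h2, h3, ← qNum_eq_qInt, qFactorial, qFactorial, Finset.prod_range_succ]
    ring

theorem oscFEps_pow_ket (i k : ℕ) {m : ℕ → ℤ} (hm : ∀ j < i, m j = 0) :
    (oscFEps q i ^ k) (ket m) =
      (-q⁻¹) ^ (i * k) • ket (Pi.single i (k : ℤ) + m) := by
  induction k with
  | zero => simp
  | succ k ih =>
    rw [pow_succ', Module.End.mul_apply, ih, map_smul, Nat.mul_succ, pow_add, mul_smul]
    congr 1
    funext m'
    rw [oscFEps, wshift_apply, Pi.smul_apply, smul_eq_mul]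
    have h3 : m' + -Pi.single i 1 = Pi.single i (k : ℤ) + m ↔
        m' = Pi.single i ((k + 1 : ℕ) : ℤ) + m := by
      rw [add_neg_eq_iff_eq_add, Nat.cast_add, Nat.cast_one, Pi.single_add, add_right_comm]
    rw [ket_apply, ket_apply]
    by_cases h : m' = Pi.single i ((k + 1 : ℕ) : ℤ) + m
    · rw [if_pos (h3.2 h), if_pos h]
      congr 1
      rw [Finset.prod_congr rfl (g := fun _ => -q⁻¹), Finset.prod_const, Finset.card_range]
      intro j hj
      rw [Finset.mem_range] at hj
      rw [h, Pi.add_apply, hm j hj, Pi.single_eq_of_ne hj.ne]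
      simp
    · rw [if_neg (fun h' => h (h3.1 h')), if_neg h, mul_zero, mul_zero]

/-- The vector whose `i`th coordinate is `k i` for `i` in a list. -/
def listVec (k : Fin n → ℕ) (l : List (Fin n)) : ℕ → ℤ :=
  (l.map fun i : Fin n => (Pi.single (i : ℕ) (k i : ℤ) : ℕ → ℤ)).sum

theorem listVec_cons (k : Fin n → ℕ) (i : Fin n) (l : List (Fin n)) :
    listVec k (i :: l) = Pi.single (i : ℕ) (k i : ℤ) + listVec k l := by
  simp [listVec]

theorem listVec_eq_zero {k : Fin n → ℕ} {l : List (Fin n)} {j : ℕ}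
    (h : ∀ i ∈ l, (i : ℕ) ≠ j) : listVec k l j = 0 := by
  induction l with
  | nil => simp [listVec]
  | cons i l ih =>
    rw [listVec_cons, Pi.add_apply, ih fun a ha => h a (List.mem_cons_of_mem _ ha),
      Pi.single_eq_of_ne (h i List.mem_cons_self).symm, add_zero]

theorem reverse_prod_oscEEps_apply (k : Fin n → ℕ) (l : List (Fin n)) (hl : l.Pairwise (· < ·))
    (ψ : (ℕ → ℤ) → ℂ) :
    (l.map fun i : Fin n => oscEEps q C i ^ k i).reverse.prod ψ 0 =
      (l.map fun i : Fin n => C ^ k i * (-q) ^ ((i : ℕ) * k i) * qFactorial q (k i)).prod *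
        ψ (listVec k l) := by
  induction l generalizing ψ with
  | nil => simp [listVec]
  | cons i l ih =>
    rw [List.pairwise_cons] at hl
    rw [List.map_cons, List.reverse_cons, List.prod_append, List.prod_singleton,
      Module.End.mul_apply, ih hl.2, oscEEps_pow_apply, List.map_cons, List.prod_cons,
      listVec_cons]
    · ring
    · intro j hj
      refine listVec_eq_zero fun a ha => ?_
      have := Fin.lt_def.1 (hl.1 a ha)
      omega

theorem prod_oscFEps_ket (k : Fin n → ℕ) (l : List (Fin n)) (hl : l.Pairwise (· < ·)) :
    (l.map fun i : Fin n => oscFEps q i ^ k i).prod (ket 0) =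
      (l.map fun i : Fin n => (-q⁻¹) ^ ((i : ℕ) * k i)).prod • ket (listVec k l) := by
  induction l with
  | nil => simp [listVec]
  | cons i l ih =>
    rw [List.pairwise_cons] at hl
    rw [List.map_cons, List.prod_cons, Module.End.mul_apply, ih hl.2, map_smul,
      oscFEps_pow_ket, List.map_cons, List.prod_cons, listVec_cons, smul_smul, mul_comm]
    intro j hj
    refine listVec_eq_zero fun a ha => ?_
    have := Fin.lt_def.1 (hl.1 a ha)
    omega

theorem listVec_finRange_apply (k : Fin n → ℕ) (j : Fin n) :
    listVec k (List.finRange n) j = k j := by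
  rw [listVec, ← Fin.sum_univ_def, Finset.sum_apply]
  simp [Pi.single_apply, Fin.val_inj]

theorem listVec_finRange_inj {k m : Fin n → ℕ} :
    listVec k (List.finRange n) = listVec m (List.finRange n) ↔ k = m := by
  refine ⟨fun h => funext fun j => ?_, fun h => by rw [h]⟩
  have := congrFun h j
  rw [listVec_finRange_apply, listVec_finRange_apply] at this
  exact_mod_cast this

theorem matrixCoeff_monomials (hq : q ≠ 0) (hq2 : q - q⁻¹ ≠ 0)
    (hρe : ∀ i, ρ (gen q (Gen.e i)) = oscE q C i)
    (hρf : ∀ i, ρ (gen q (Gen.f i)) = oscF q i) (k m : Fin n → ℕ) :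
    ρ (eMonomial q k * fMonomial q m) (ket 0) 0 =
      ∏ i, (if k i = m i then 1 else 0) * (C ^ m i * qFactorial q (m i)) := by
  have he : ρ (eMonomial q k) =
      ((List.finRange n).map fun i : Fin n => oscEEps q C i ^ k i).reverse.prod := by
    rw [eMonomial, map_list_prod, List.map_reverse, List.ofFn_eq_map, List.map_map]
    congr 2
    refine List.map_congr_left fun i _ => ?_
    rw [Function.comp_apply, map_pow, map_eEps hq hq2 hρe]
  have hf : ρ (fMonomial q m) =
      ((List.finRange n).map fun i : Fin n => oscFEps q i ^ m i).prod := by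
    rw [fMonomial, map_list_prod, List.ofFn_eq_map, List.map_map]
    congr 1
    refine List.map_congr_left fun i _ => ?_
    rw [Function.comp_apply, map_pow, map_fEps hq hq2 hρf]
  have hl : (List.finRange n).Pairwise (· < ·) := List.pairwise_lt_finRange n
  rw [map_mul, Module.End.mul_apply, he, hf, prod_oscFEps_ket m _ hl,
    reverse_prod_oscEEps_apply k _ hl, Pi.smul_apply, ket_apply, smul_eq_mul,
    listVec_finRange_inj, ← Fin.prod_univ_def, ← Fin.prod_univ_def]
  by_cases h : k = m
  · subst h
    rw [if_pos rfl, mul_one, ← Finset.prod_mul_distrib]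
    refine Finset.prod_congr rfl fun i _ => ?_
    -- The twists picked up by the `e`- and `f`-powers are mutually inverse.
    have h1 : (-q) ^ ((i : ℕ) * k i) * (-q⁻¹) ^ ((i : ℕ) * k i) = 1 := by
      rw [← mul_pow, neg_mul_neg, mul_inv_cancel₀ hq, one_pow]
    rw [if_pos rfl]
    linear_combination C ^ k i * qFactorial q (k i) * h1
  · rw [if_neg h, mul_zero, mul_zero]
    obtain ⟨i, hi⟩ := Function.ne_iff.1 h
    exact (Finset.prod_eq_zero (Finset.mem_univ i) (by rw [if_neg hi, zero_mul])).symm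

/-- The functions that vanish outside the non-negative integers. -/
def nonnegSupported : Submodule ℂ ((ℕ → ℤ) → ℂ) where
  carrier := {ψ | ∀ m, ψ m ≠ 0 → ∀ l, 0 ≤ m l}
  zero_mem' m h := absurd rfl h
  add_mem' {a b} ha hb m h := by
    by_cases h' : a m = 0
    · exact hb m fun hb' => h (by rw [Pi.add_apply, h', hb', add_zero])
    · exact ha m h'
  smul_mem' c a ha m h := ha m fun h' => h (by rw [Pi.smul_apply, h', smul_zero])

theorem mem_nonnegSupported {ψ : (ℕ → ℤ) → ℂ} :
    ψ ∈ nonnegSupported ↔ ∀ m, ψ m ≠ 0 → ∀ l, 0 ≤ m l := Iff.rfl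

theorem ket_mem_nonnegSupported : ket 0 ∈ nonnegSupported := by
  rw [mem_nonnegSupported]
  intro m h l
  rw [ket_apply] at h
  split_ifs at h with h'
  · simp [h']
  · exact absurd rfl h

theorem oscK_mem_nonnegSupported {ψ : (ℕ → ℤ) → ℂ} (hψ : ψ ∈ nonnegSupported) (i : ℕ) :
    oscK q κ i ψ ∈ nonnegSupported := by
  intro m h l
  rw [oscK, wshift_apply, add_zero] at h
  exact hψ m (right_ne_zero_of_mul h) l

/-- The only way out of the cone is at `m i = -1`, where the coefficient `[m i + 1]` vanishes. -/
theorem oscE_mem_nonnegSupported {ψ : (ℕ → ℤ) → ℂ} (hψ : ψ ∈ nonnegSupported) (i : ℕ) :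
    oscE q C i ψ ∈ nonnegSupported := by
  intro m h l
  rw [oscE, wshift_apply] at h
  have h1 := hψ _ (right_ne_zero_of_mul h) l
  have h2 : m i + 1 ≠ 0 := fun h' => left_ne_zero_of_mul h (by simp [oscECoeff, h', qInt_zero])
  have h3 := hψ _ (right_ne_zero_of_mul h) i
  rw [Pi.add_apply, natRoot_self] at h3
  rw [Pi.add_apply] at h1
  rcases eq_or_ne l i with rfl | hli
  · omega
  · have : natRoot i l ≤ 0 := by
      simp only [natRoot, hli, if_false]
      split_ifs <;> simp
    omega

theorem oscF_mem_nonnegSupported {ψ : (ℕ → ℤ) → ℂ} (hψ : ψ ∈ nonnegSupported) (i : ℕ) :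
    oscF q i ψ ∈ nonnegSupported := by
  intro m h l
  rw [oscF, wshift_apply] at h
  have h1 := hψ _ (right_ne_zero_of_mul h) l
  rw [Pi.add_apply, Pi.neg_apply] at h1
  rcases eq_or_ne (l + 1) i with rfl | hli
  · have h2 : m l + 1 ≠ 0 := fun h' => left_ne_zero_of_mul h (by
      simp [oscFCoeff, h', qInt_zero])
    rw [natRoot_succ_self] at h1
    omega
  · have : 0 ≤ natRoot i l := by
      simp only [natRoot, hli, if_false]
      split_ifs <;> simp
    omega

/-- The shift reads `ψ` at a point whose `i`th coordinate is `-1`. This is where restricting the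
support is needed: arbitrary functions may be nonzero there. -/
theorem oscF_apply_zero {ψ : (ℕ → ℤ) → ℂ} (hψ : ψ ∈ nonnegSupported) (i : ℕ) :
    oscF q i ψ 0 = 0 := by
  rw [oscF, wshift_apply, zero_add]
  by_contra h
  have h1 := hψ _ (right_ne_zero_of_mul h) i
  rw [Pi.neg_apply, natRoot_self] at h1
  omega

theorem oscE_ket (i : ℕ) : oscE q C i (ket 0) = 0 := by
  funext m
  rw [oscE, wshift_apply, Pi.zero_apply, ket_apply]
  split_ifs with h
  · have h1 := congrFun h i
    rw [Pi.add_apply, natRoot_self, Pi.zero_apply] at h1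
    simp [oscECoeff, h1, qInt_zero]
  · rw [mul_zero]

theorem oscK_apply_zero (ψ : (ℕ → ℤ) → ℂ) (i : ℕ) : oscK q κ i ψ 0 = oscWeight κ i * ψ 0 := by
  simp [oscK, wshift_apply, rootPairing]

theorem map_mem_nonnegSupported
    (hρe : ∀ i, ρ (gen q (Gen.e i)) = oscE q C i) (hρf : ∀ i, ρ (gen q (Gen.f i)) = oscF q i)
    (hρK : ∀ i, ρ (gen q (Gen.K i)) = oscK q κ i)
    (hρK' : ∀ i, ρ (gen q (Gen.Kinv i)) = oscK q⁻¹ κ⁻¹ i) (x : Uq n q) :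
    ∀ ψ ∈ nonnegSupported, ρ x ψ ∈ nonnegSupported := by
  have hx : x ∈ Algebra.adjoin ℂ (Set.range (gen (n := n) q)) := by
    rw [adjoin_range_gen]; trivial
  induction hx using Algebra.adjoin_induction with
  | mem s hs =>
    obtain ⟨g, rfl⟩ := hs
    intro ψ hψ
    cases g with
    | K i => rw [hρK]; exact oscK_mem_nonnegSupported hψ i
    | Kinv i => rw [hρK']; exact oscK_mem_nonnegSupported hψ i
    | e i => rw [hρe]; exact oscE_mem_nonnegSupported hψ i
    | f i => rw [hρf]; exact oscF_mem_nonnegSupported hψ i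
  | algebraMap r =>
    intro ψ hψ
    rw [AlgHom.commutes, Module.algebraMap_end_apply]
    exact Submodule.smul_mem _ _ hψ
  | add a b _ _ ha hb =>
    intro ψ hψ
    rw [map_add, LinearMap.add_apply]
    exact add_mem (ha ψ hψ) (hb ψ hψ)
  | mul a b _ _ ha hb =>
    intro ψ hψ
    rw [map_mul, Module.End.mul_apply]
    exact ha _ (hb ψ hψ)

theorem exists_oscillator_functional (n : ℕ) (hq : q ≠ 0) (hq2 : q - q⁻¹ ≠ 0)
    (hκ : κ ^ 2 = -q⁻¹) (hC : C * (κ * (q - 1)) = -1) :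
    ∃ Φ : Uq n q →ₗ[ℂ] ℂ, IsHighestWeightFunctional Φ (fun i => oscWeight κ i)
      (fun i => oscWeight κ⁻¹ i) ∧
      ∀ k m : Fin n → ℕ, Φ (eMonomial q k * fMonomial q m) =
        ∏ i, (if k i = m i then 1 else 0) * (C ^ m i * qFactorial q (m i)) := by
  obtain ⟨ρ, hρe, hρf, hρK, hρK'⟩ := exists_oscillator n hq hq2 hκ hC
  let Φ : Uq n q →ₗ[ℂ] ℂ :=
    { toFun := fun x => ρ x (ket 0) 0
      map_add' := fun x y => by simp
      map_smul' := fun r x => by simp }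
  refine ⟨Φ, ⟨?_, fun i x => ?_, fun i x => ?_, fun i x => ?_, fun i x => ?_⟩,
    matrixCoeff_monomials hq hq2 hρe hρf⟩
  · change ρ 1 (ket 0) 0 = 1
    simp [ket_apply]
  · change ρ (_ * x) (ket 0) 0 = 0
    rw [map_mul, hρf, Module.End.mul_apply]
    exact oscF_apply_zero
      (map_mem_nonnegSupported hρe hρf hρK hρK' x _ ket_mem_nonnegSupported) i
  · change ρ (x * _) (ket 0) 0 = 0
    rw [map_mul, hρe, Module.End.mul_apply, oscE_ket, map_zero, Pi.zero_apply]
  · change ρ (_ * x) (ket 0) 0 = _ * ρ x (ket 0) 0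
    rw [map_mul, hρK, Module.End.mul_apply, oscK_apply_zero]
  · change ρ (_ * x) (ket 0) 0 = _ * ρ x (ket 0) 0
    rw [map_mul, hρK', Module.End.mul_apply, oscK_apply_zero]

end RootVectors

/-! ### Exponentials of the special weight. -/

section Weights

variable {n : ℕ}

theorem weightForm_of_val_eq_zero (lam : Fin n → ℂ) {i : Fin n} (hi : (i : ℕ) = 0) :
    weightForm lam i = lam i := by
  simp [weightForm, simpleRoot_of_val_eq_zero hi, Pi.single_apply]

theorem weightForm_of_val_eq_succ (lam : Fin n → ℂ) {i k : Fin n} (hi : (i : ℕ) = k + 1) :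
    weightForm lam i = lam i - lam k := by
  simp [weightForm, simpleRoot_of_val_eq_succ hi, Pi.single_apply, mul_sub]

theorem eq_of_weightForm_eq_zero {lam : Fin n → ℂ}
    (h : ∀ i : Fin n, 0 < (i : ℕ) → weightForm lam i = 0) (i j : Fin n) : lam i = lam j := by
  have h0 (m : ℕ) (hm : m < n) : lam ⟨m, hm⟩ = lam ⟨0, by omega⟩ := by
    induction m with
    | zero => rfl
    | succ m ih =>
      have h1 := h ⟨m + 1, hm⟩ (Nat.succ_pos m)
      rw [weightForm_of_val_eq_succ lam (k := ⟨m, by omega⟩) rfl, sub_eq_zero] at h1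
      rw [h1, ih]
  rw [h0 i i.2, h0 j j.2]

theorem exists_exp_weight {q hbar : ℂ} {lam : Fin n → ℂ}
    (h : ∀ i : Fin n, 0 < (i : ℕ) → weightForm lam i = 0)
    (hlam : ∀ i : Fin n, Complex.exp (hbar * (2 * lam i)) = -q⁻¹) :
    ∃ κ : ℂ, κ ^ 2 = -q⁻¹ ∧ (∀ i, Complex.exp (hbar * lam i) = κ) ∧
      ∀ i : Fin n, Complex.exp (hbar * weightForm lam i) = oscWeight κ i := by
  rcases Nat.eq_zero_or_pos n with rfl | hn
  -- For `n = 0` no coordinate of the weight determines `κ`, so any square root serves.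
  · obtain ⟨κ, hκ⟩ := IsAlgClosed.exists_pow_nat_eq (-q⁻¹) (n := 2) (by norm_num)
    exact ⟨κ, hκ, fun i => i.elim0, fun i => i.elim0⟩
  · have h1 (i) : Complex.exp (hbar * lam i) = Complex.exp (hbar * lam ⟨0, hn⟩) := by
      rw [eq_of_weightForm_eq_zero h i]
    refine ⟨Complex.exp (hbar * lam ⟨0, hn⟩), ?_, h1, fun i => ?_⟩
    · rw [← hlam ⟨0, hn⟩, ← Complex.exp_nat_mul]
      congr 1; push_cast; ring
    · rcases Nat.eq_zero_or_pos (i : ℕ) with hi | hi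
      · rw [weightForm_of_val_eq_zero lam hi, h1, oscWeight, if_pos hi]
      · rw [h i hi, mul_zero, Complex.exp_zero, oscWeight, if_neg hi.ne']

end Weights

end QSO

end

theorem mainTheorem5 (n : ℕ) (q hbar θ : ℂ) (hq : q = Complex.exp hbar)
    (hroot : ∀ k : ℕ, 0 < k → q ^ k ≠ 1)
    (hθ : θ = Complex.exp (hbar / 2) - Complex.exp (-(hbar / 2)))
    (lam : Fin n → ℂ)
    (hlam : ∀ i : Fin n, Complex.exp (hbar * (2 * lam i)) = -q⁻¹)
    (hlam' : ∀ i : Fin n, 0 < (i : ℕ) → QSO.weightForm lam i = 0) :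
    ∃ hs : QSO.CartanSplits n q,
      (∃! ev : QSO.cartan n q →ₐ[ℂ] ℂ, QSO.IsEvalAt hbar lam ev) ∧
      ∀ ev : QSO.cartan n q →ₐ[ℂ] ℂ, QSO.IsEvalAt hbar lam ev →
        ∀ k m : Fin n → ℕ,
          ev (QSO.harishChandra hs (QSO.eMonomial q k * QSO.fMonomial q m)) =
            ∏ i : Fin n, (if k i = m i then 1 else 0) * QSO.qFactorial q (m i) *
              θ ^ (-(m i : ℤ)) *
              Complex.exp (hbar * (-(m i : ℂ) * lam i - (m i : ℂ) / 2)) * (-1) ^ m i := by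
  have hq0 : q ≠ 0 := hq ▸ Complex.exp_ne_zero _
  have hq1 : q - 1 ≠ 0 := fun h => hroot 1 one_pos (by rw [pow_one, sub_eq_zero.1 h])
  have hq2 : q - q⁻¹ ≠ 0 := fun h => hroot 2 two_pos (by
    rw [pow_two]
    nth_rw 1 [sub_eq_zero.1 h]
    exact inv_mul_cancel₀ hq0)
  obtain ⟨κ, hκ, hκlam, hκev⟩ := QSO.exists_exp_weight hlam' hlam
  have hκ0 : κ ≠ 0 := by rintro rfl; simp [hq0] at hκ
  -- This identifies the oscillator constant `C = -(κ(q-1))⁻¹` with `-θ⁻¹ q^{-(λ,ε_i)-1/2}`, the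
  -- factor in the claim.
  have hθ' : θ * Complex.exp (hbar / 2) = q - 1 := by
    rw [hθ, sub_mul, ← Complex.exp_add, ← Complex.exp_add, hq, add_halves, neg_add_cancel,
      Complex.exp_zero]
  have hθ0 : θ ≠ 0 := by rintro rfl; exact hq1 (by rw [← hθ', zero_mul])
  obtain ⟨Φ, hΦ, hmon⟩ := QSO.exists_oscillator_functional n (C := -(κ * (q - 1))⁻¹) hq0 hq2 hκ
    (by rw [neg_mul, inv_mul_cancel₀ (mul_ne_zero hκ0 hq1)])
  refine ⟨QSO.cartanSplits n hq0, QSO.existsUnique_isEvalAt hq0 hbar lam, fun ev hev k m => ?_⟩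
  rw [QSO.eval_harishChandra _ hΦ (fun i => (hev i).trans (hκev i)), hmon]
  refine Finset.prod_congr rfl fun i _ => ?_
  have h1 : Complex.exp (hbar * (-(m i : ℂ) * lam i - (m i : ℂ) / 2)) =
      (κ⁻¹ * (Complex.exp (hbar / 2))⁻¹) ^ m i := by
    rw [← hκlam i, ← Complex.exp_neg, ← Complex.exp_neg, ← Complex.exp_add, ← Complex.exp_nat_mul]
    congr 1
    ring
  rw [h1, ← hθ', zpow_neg, zpow_natCast, ← inv_pow, neg_pow]
  simp only [mul_inv, mul_pow]
  ring
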